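/- Let $\mathbb{F}\in\{\mathbb{R},\mathbb{C}\}$ and let $M$ be a Hausdorff smooth manifold (of dimension $n$, locally modelled on $\mathbb{R}^n$, without boundary). Let $R=C_c^\infty(M)$ be the commutative ring, in general without identity, of smooth $\mathbb{F}$-valued functions with compact support on $M$. **Sheaves.** $\mathrm{Sh}(M)$ is the category whose objects are local diffeomorphisms $\pi:E\to M$ from a not necessarily Hausdorff manifold $E$, and whose morphisms are smooth maps over $M$. **Coalgebras.** An $R$-module $C$ is locally unitary if for any $c_1,\dots,c_k\in C$ there is $r\in R$ with $rc_i=c_i$ for all $i$. A coalgebra over $R$ is a locally unitary $R$-module $C$ with $R$-linear maps $\Delta:C\to C\otimes_R C$ and $\epsilon:C\to R$ such that $(\mathrm{id}\otimes\epsilon)\circ\Delta=\mathrm{id}=(\epsilon\otimes\mathrm{id})\circ\Delta$ (under $C\otimes_R R\cong C\cong R\otimes_R C$). Homomorphisms of coalgebras are the $R$-linear maps that commute with $\Delta$ and $\epsilon$. The resulting category is $\mathrm{CoAlg}(R)$. **The functor $C_c^\infty$.** For a not necessarily Hausdorff manifold $E$, the space $C_c^\infty(E)$ consists of the finite sums,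 in the space of all (not necessarily continuous) sections $y\mapsto u_y$ of the sheaf of germs of smooth $\mathbb{F}$-valued functions on $E$, of extensions by zero of smooth functions with compact support on Hausdorff open subsets of $E$; for Hausdorff $E$ these are the usual smooth functions with compact support. A local diffeomorphism $\phi:E\to F$ induces $\phi_+:C_c^\infty(E)\to C_c^\infty(F)$, $\phi_+(u)_z=\sum_{y\in\phi^{-1}(z)}\phi_{*y}(u_y)$, where $\phi_{*y}$ is the inverse of the isomorphism of germs given by composition with $\phi$. For a sheaf $\pi:E\to M$, $R$ acts on $C_c^\infty(E)$ by $(fu)_y=(f\circ\pi)_y\,u_y$. For two sheaves $E,F$ on $M$ there is a natural isomorphism $\Omega:C_c^\infty(E)\otimes_R C_c^\infty(F)\to C_c^\infty(E\times_M F)$, $\Omega(u\otimes v)_{(y,z)}=\mathrm{pr}_1^*(u_y)\,\mathrm{pr}_2^*(v_z)$, and $C_c^\infty(E)$ is a coalgebra over $R$ with $\Delta=\Omega^{-1}\circ\mathrm{diag}_+$ and $\epsilon=\pi_+$, where $\mathrm{diag}:E\to E\times_M E$ is the diagonal. With $\phi\mapsto\phi_+$ on morphisms this defines a functor $C_c^\infty:\mathrm{Sh}(M)\to\mathrm{CoAlg}(C_c^\infty(M))$.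 **The functor $\mathcal{E}_{sp}$.** For a coalgebra $C$ over $R$ and $x\in M$ put $N_x(C)=\{c\in C : fc=0 \text{ for some } f\in R \text{ equal to } 1 \text{ near } x\}$, $C_x=C/N_x(C)$, and write $c_x$ for the class of $c\in C$. Then $C_x$ is a coalgebra over the ring $R_x$ of germs at $x$ of smooth functions, with the induced $\Delta_x$ and $\epsilon_x$; let $G(C_x)=\{\zeta\in C_x:\Delta_x(\zeta)=\zeta\otimes\zeta,\ \epsilon_x(\zeta)=1\}$ be its set of grouplike elements. The spectral sheaf $\mathcal{E}_{sp}(C)$ is the disjoint union of the sets $G(C_x)$, $x\in M$, with the obvious projection to $M$ (so its stalk at $x$ is $G(C_x)$), with the topology that has as basis the sets $c_W=\{c_x : x\in W\}$, where $W\subset M$ is open and $c\in C$ satisfies $\Delta(c)=c\otimes c'$ for some $c'\in C$ and $\epsilon(c)_x=1$ as a germ for every $x\in W$, and with the smooth structure for which the projection is a local diffeomorphism. A homomorphism $\alpha:C\to D$ induces maps $\alpha_x:C_x\to D_x$, which restrict to $G(C_x)\to G(D_x)$ and define $\mathcal{E}_{sp}(\alpha):\mathcal{E}_{sp}(C)\to\mathcal{E}_{sp}(D)$.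 This gives a functor $\mathcal{E}_{sp}:\mathrm{CoAlg}(C_c^\infty(M))\to\mathrm{Sh}(M)$. **Theorem.** The functor $C_c^\infty:\mathrm{Sh}(M)\to\mathrm{CoAlg}(C_c^\infty(M))$ is left adjoint to $\mathcal{E}_{sp}:\mathrm{CoAlg}(C_c^\infty(M))\to\mathrm{Sh}(M)$, and it is fully faithful. -/

import Mathlib

open scoped Manifold ContDiff Topology
open Filter CategoryTheory

universe u v

namespace SheafCoalg

noncomputable section Algebra

/-- A (left) module `C` over a commutative ring `R` that need not have an identity. -/
class NUModule (R : Type*) [NonUnitalCommRing R] (C : Type*) [AddCommGroup C] extends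
    SMul R C where
  smul_add' : ∀ (r : R) (c d : C), r • (c + d) = r • c + r • d
  add_smul' : ∀ (r s : R) (c : C), (r + s) • c = r • c + s • c
  mul_smul' : ∀ (r s : R) (c : C), (r * s) • c = r • s • c

variable {R : Type*} [NonUnitalCommRing R]
variable {C C' C'' D D' D'' A : Type*} [AddCommGroup C] [AddCommGroup C'] [AddCommGroup C'']
  [AddCommGroup D] [AddCommGroup D'] [AddCommGroup D''] [AddCommGroup A]
  [NUModule R C] [NUModule R C'] [NUModule R C''] [NUModule R D] [NUModule R D'] [NUModule R D'']
  [NUModule R A]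

/-- The commutative ring `R` as a module over itself. -/
instance NUModule.self : NUModule R R where
  smul_add' := mul_add
  add_smul' := add_mul
  mul_smul' := mul_assoc

/-- Multiplication by `r` as an additive endomorphism. -/
def smulHom (r : R) : C →+ C where
  toFun c := r • c
  map_zero' := by
    have := NUModule.smul_add' r (0 : C) 0
    simpa using this
  map_add' := NUModule.smul_add' r

@[simp] theorem smulHom_apply (r : R) (c : C) : smulHom r c = r • c := rfl

theorem nu_smul_zero (r : R) : r • (0 : C) = 0 := (smulHom r).map_zero
theorem nu_smul_add (r : R) (c d : C) : r • (c + d) = r • c + r • d := (smulHom r).map_add c d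
theorem nu_smul_neg (r : R) (c : C) : r • (-c) = -(r • c) := (smulHom r).map_neg c
theorem nu_smul_sub (r : R) (c d : C) : r • (c - d) = r • c - r • d := (smulHom r).map_sub c d

/-- The additive map `r ↦ r • c`. -/
def smulFlip (c : C) : R →+ C where
  toFun r := r • c
  map_zero' := by
    have := NUModule.add_smul' (0 : R) 0 c
    simpa using this
  map_add' r s := NUModule.add_smul' r s c

theorem nu_zero_smul (c : C) : (0 : R) • c = 0 := (smulFlip c).map_zero
theorem nu_add_smul (r s : R) (c : C) : (r + s) • c = r • c + s • c := (smulFlip c).map_add r s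
theorem nu_sub_smul (r s : R) (c : C) : (r - s) • c = r • c - s • c := (smulFlip c).map_sub r s
theorem nu_mul_smul (r s : R) (c : C) : (r * s) • c = r • s • c := NUModule.mul_smul' r s c
theorem nu_smul_comm (r s : R) (c : C) : r • s • c = s • r • c := by
  rw [← nu_mul_smul, mul_comm, nu_mul_smul]
theorem nu_self_smul (r s : R) : r • s = r * s := rfl

variable (R) in
/-- Locally unitary modules: finitely many elements have a common identity in `R`. -/
def IsLocallyUnitary (C : Type*) [AddCommGroup C] [NUModule R C] : Prop :=
  ∀ s : Finset C, ∃ r : R, ∀ c ∈ s, r • c = c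

/-- It is enough to have an identity for each single element. -/
theorem isLocallyUnitary_of_forall (h : ∀ c : C, ∃ r : R, r • c = c) :
    IsLocallyUnitary R C := by
  classical
  intro s
  induction s using Finset.induction_on with
  | empty => exact ⟨0, by simp⟩
  | insert a s ha ih =>
    obtain ⟨r, hr⟩ := ih
    obtain ⟨t, ht⟩ := h a
    refine ⟨r + t - r * t, fun c hc => ?_⟩
    rw [nu_sub_smul, nu_add_smul]
    rcases Finset.mem_insert.1 hc with rfl | hc
    · rw [nu_mul_smul, ht]; abel
    · rw [mul_comm, nu_mul_smul, hr c hc]; abel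

variable (R) in
/-- `R`-linear maps. -/
structure NULin (C D : Type*) [AddCommGroup C] [AddCommGroup D] [NUModule R C] [NUModule R D]
    extends C →+ D where
  map_smul' : ∀ (r : R) (c : C), toFun (r • c) = r • toFun c

instance : CoeFun (NULin R C D) fun _ => C → D := ⟨fun f => f.toAddMonoidHom⟩

theorem NULin.map_smul (f : NULin R C D) (r : R) (c : C) : f (r • c) = r • f c := f.map_smul' r c

@[ext] theorem NULin.ext {f g : NULin R C D} (h : ∀ c, f c = g c) : f = g := by
  cases f; cases g; congr 1; exact AddMonoidHom.ext h

/-- The identity map. -/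
def NULin.id (C : Type*) [AddCommGroup C] [NUModule R C] : NULin R C C where
  toAddMonoidHom := AddMonoidHom.id C
  map_smul' _ _ := rfl

/-- The composition of `R`-linear maps. -/
def NULin.comp (g : NULin R D A) (f : NULin R C D) : NULin R C A where
  toAddMonoidHom := g.toAddMonoidHom.comp f.toAddMonoidHom
  map_smul' r c := by
    change g (f (r • c)) = r • g (f c)
    rw [f.map_smul, g.map_smul]

@[simp] theorem NULin.id_apply (c : C) : NULin.id (R := R) C c = c := rfl
@[simp] theorem NULin.comp_apply (g : NULin R D A) (f : NULin R C D) (c : C) :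
    g.comp f c = g (f c) := rfl

open TensorProduct in
variable (R) in
/-- The relations `r c ⊗ d = c ⊗ r d`. -/
def balanceRel (C D : Type*) [AddCommGroup C] [AddCommGroup D] [NUModule R C] [NUModule R D] :
    AddSubgroup (C ⊗[ℤ] D) :=
  AddSubgroup.closure
    {t | ∃ (r : R) (c : C) (d : D), t = (r • c) ⊗ₜ[ℤ] d - c ⊗ₜ[ℤ] (r • d)}

open TensorProduct in
variable (R) in
/-- The tensor product of two modules over the (non-unital) commutative ring `R`: the quotient of
the tensor product of abelian groups by the relations `r c ⊗ d = c ⊗ r d`. -/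
def BTensor (C D : Type*) [AddCommGroup C] [AddCommGroup D] [NUModule R C] [NUModule R D] :
    Type _ :=
  (C ⊗[ℤ] D) ⧸ balanceRel R C D

instance : AddCommGroup (BTensor R C D) :=
  inferInstanceAs (AddCommGroup ((TensorProduct ℤ C D) ⧸ balanceRel R C D))

namespace BTensor

variable (R) in
/-- The pure tensor `c ⊗ d`. -/
def tmul (c : C) (d : D) : BTensor R C D :=
  QuotientAddGroup.mk' (balanceRel R C D) (TensorProduct.tmul ℤ c d)

theorem add_tmul (c c' : C) (d : D) : tmul R (c + c') d = tmul R c d + tmul R c' d := by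
  simp only [tmul, TensorProduct.add_tmul]; exact map_add _ _ _

theorem tmul_add (c : C) (d d' : D) : tmul R c (d + d') = tmul R c d + tmul R c d' := by
  simp only [tmul, TensorProduct.tmul_add]; exact map_add _ _ _

theorem smul_tmul (r : R) (c : C) (d : D) : tmul R (r • c) d = tmul R c (r • d) := by
  rw [← sub_eq_zero]
  refine (map_sub (QuotientAddGroup.mk' (balanceRel R C D)) _ _).symm.trans ?_
  exact (QuotientAddGroup.eq_zero_iff _).2 (AddSubgroup.subset_closure ⟨r, c, d, rfl⟩)

theorem zero_tmul (d : D) : tmul R (0 : C) d = 0 := by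
  simp only [tmul, TensorProduct.zero_tmul]; exact map_zero _

theorem tmul_zero (c : C) : tmul R c (0 : D) = 0 := by
  simp only [tmul, TensorProduct.tmul_zero]; exact map_zero _

theorem induction_on {p : BTensor R C D → Prop} (t : BTensor R C D) (h0 : p 0)
    (h1 : ∀ c d, p (tmul R c d)) (h2 : ∀ s t, p s → p t → p (s + t)) : p t := by
  obtain ⟨t, rfl⟩ := QuotientAddGroup.mk'_surjective (balanceRel R C D) t
  induction t using TensorProduct.induction_on with
  | zero => rw [map_zero]; exact h0
  | tmul c d => exact h1 c d
  | add s t hs ht => rw [map_add]; exact h2 _ _ hs ht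

/-- The additive map out of the tensor product given by a balanced biadditive map. -/
def lift {B : Type*} [AddCommGroup B] (b : C →+ D →+ B)
    (hb : ∀ (r : R) c d, b (r • c) d = b c (r • d)) : BTensor R C D →+ B :=
  QuotientAddGroup.lift (balanceRel R C D)
    (TensorProduct.liftAddHom b (fun n c d => by simp)) (by
      intro t ht
      refine (AddSubgroup.closure_le (K := AddMonoidHom.ker _)).2 ?_ ht
      rintro _ ⟨r, c, d, rfl⟩
      simp [AddMonoidHom.mem_ker, hb])

@[simp] theorem lift_tmul {B : Type*} [AddCommGroup B] (b : C →+ D →+ B)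
    (hb : ∀ (r : R) c d, b (r • c) d = b c (r • d)) (c : C) (d : D) :
    lift b hb (tmul R c d) = b c d := rfl

/-- The biadditive map `(c, d) ↦ c ⊗ d`. -/
def mkHom : C →+ D →+ BTensor R C D :=
  AddMonoidHom.mk' (fun c => AddMonoidHom.mk' (fun d => tmul R c d) (tmul_add c))
    (fun c c' => by ext d; exact add_tmul c c' d)

@[simp] theorem mkHom_apply (c : C) (d : D) : mkHom (R := R) c d = tmul R c d := rfl

theorem hom_ext {B : Type*} [AddCommGroup B] {f g : BTensor R C D →+ B}
    (h : ∀ c d, f (tmul R c d) = g (tmul R c d)) : f = g := by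
  ext t
  induction t using induction_on with
  | h0 => simp
  | h1 c d => exact h c d
  | h2 s t hs ht => simp [hs, ht]

/-- Multiplication by `r` on the tensor product, `r (c ⊗ d) = r c ⊗ d`. -/
def smulMap (r : R) : BTensor R C D →+ BTensor R C D :=
  lift (mkHom.comp (smulHom r)) (fun s c d => by
    simp only [AddMonoidHom.comp_apply, smulHom_apply, mkHom_apply]
    rw [nu_smul_comm, smul_tmul])

@[simp] theorem smulMap_tmul (r : R) (c : C) (d : D) :
    smulMap r (tmul R c d) = tmul R (r • c) d := rfl

/-- The `R`-module structure of the tensor product, `r (c ⊗ d) = r c ⊗ d`. -/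
instance : NUModule R (BTensor R C D) where
  smul r t := smulMap r t
  smul_add' r s t := map_add _ _ _
  add_smul' r s t := by
    refine DFunLike.congr_fun (f := smulMap (r + s)) (g := smulMap r + smulMap s) (hom_ext ?_) t
    intro c d
    simp [nu_add_smul, add_tmul]
  mul_smul' r s t := by
    refine DFunLike.congr_fun (f := smulMap (r * s)) (g := (smulMap r).comp (smulMap s))
      (hom_ext ?_) t
    intro c d
    simp [nu_mul_smul]

theorem smul_def_tmul (r : R) (c : C) (d : D) : r • tmul R c d = tmul R (r • c) d := rfl

/-- The additive map `α ⊗ β` induced by `R`-linear maps `α` and `β`. -/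
def mapHom (α : NULin R C C') (β : NULin R D D') : BTensor R C D →+ BTensor R C' D' :=
  lift (AddMonoidHom.mk' (fun c => (mkHom (α c)).comp β.toAddMonoidHom)
      (fun c c' => by ext d; simp))
    (fun r c d => by
      change tmul R (α (r • c)) (β d) = tmul R (α c) (β (r • d))
      rw [α.map_smul, β.map_smul, smul_tmul])

/-- The `R`-linear map `α ⊗ β` induced by `R`-linear maps `α` and `β`. -/
def map (α : NULin R C C') (β : NULin R D D') : NULin R (BTensor R C D) (BTensor R C' D') where
  toAddMonoidHom := mapHom α β
  map_smul' r t := by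
    refine DFunLike.congr_fun (f := (mapHom α β).comp (smulHom r))
      (g := (smulHom r).comp (mapHom α β)) (hom_ext ?_) t
    intro c d
    change tmul R (α (r • c)) (β d) = r • tmul R (α c) (β d)
    rw [α.map_smul, smul_def_tmul]

@[simp] theorem map_tmul (α : NULin R C C') (β : NULin R D D') (c : C) (d : D) :
    map α β (tmul R c d) = tmul R (α c) (β d) := rfl

theorem map_comp (α' : NULin R C' C'') (β' : NULin R D' D'') (α : NULin R C C')
    (β : NULin R D D') (t : BTensor R C D) :
    map (α'.comp α) (β'.comp β) t = map α' β' (map α β t) := by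
  induction t using induction_on with
  | h0 => simp
  | h1 c d => simp
  | h2 s t hs ht => simp [hs, ht]

theorem map_id (t : BTensor R C D) : map (NULin.id C) (NULin.id D) t = t := by
  induction t using induction_on with
  | h0 => simp
  | h1 c d => simp
  | h2 s t hs ht => simp [hs, ht]

variable (R C) in
/-- The natural map `R ⊗ C → C`, `r ⊗ c ↦ r c` (bijective for a locally unitary module `C`). -/
def leftUnitor : BTensor R R C →+ C :=
  lift (AddMonoidHom.mk' smulHom (fun r s => by ext c; exact nu_add_smul r s c))
    (fun r s c => by
      change (r * s) • c = s • r • c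
      rw [mul_comm, nu_mul_smul])

variable (R C) in
/-- The natural map `C ⊗ R → C`, `c ⊗ r ↦ r c` (bijective for a locally unitary module `C`). -/
def rightUnitor : BTensor R C R →+ C :=
  lift (AddMonoidHom.mk' smulFlip (fun c c' => by ext r; exact nu_smul_add r c c'))
    (fun r c s => by
      change s • r • c = (r * s) • c
      rw [nu_mul_smul, nu_smul_comm])

@[simp] theorem leftUnitor_tmul (r : R) (c : C) : leftUnitor R C (tmul R r c) = r • c := rfl
@[simp] theorem rightUnitor_tmul (c : C) (r : R) : rightUnitor R C (tmul R c r) = r • c := rfl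

end BTensor

end Algebra

section CoalgebraCategory

/-- A coalgebra over a commutative ring `R` (possibly without identity): a locally unitary
`R`-module with a comultiplication and a counit (neither coassociativity nor cocommutativity is
required). -/
structure CoAlg (R : Type v) [NonUnitalCommRing R] where
  carrier : Type u
  [addCommGroup : AddCommGroup carrier]
  [nuModule : NUModule R carrier]
  locallyUnitary : IsLocallyUnitary R carrier
  comul : NULin R carrier (BTensor R carrier carrier)
  counit : NULin R carrier R
  /-- `(ε ⊗ id) ∘ Δ = id`. -/
  counit_comul : ∀ c, BTensor.leftUnitor R carrier (BTensor.map counit (NULin.id _) (comul c)) = c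
  /-- `(id ⊗ ε) ∘ Δ = id`. -/
  comul_counit : ∀ c, BTensor.rightUnitor R carrier (BTensor.map (NULin.id _) counit (comul c)) = c

attribute [instance] CoAlg.addCommGroup CoAlg.nuModule

variable {R : Type v} [NonUnitalCommRing R]

/-- Homomorphisms of `R`-coalgebras. -/
@[ext] structure CoAlg.Hom (C D : CoAlg.{u} R) where
  lin : NULin R C.carrier D.carrier
  comul_lin : ∀ c, D.comul (lin c) = BTensor.map lin lin (C.comul c)
  counit_lin : ∀ c, D.counit (lin c) = C.counit c

/-- The category of `R`-coalgebras. -/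
instance : Category (CoAlg.{u} R) where
  Hom C D := CoAlg.Hom C D
  id C := ⟨NULin.id _, fun c => (BTensor.map_id _).symm, fun _ => rfl⟩
  comp f g := ⟨g.lin.comp f.lin,
    fun c => by rw [BTensor.map_comp, ← f.comul_lin, ← g.comul_lin]; rfl,
    fun c => by rw [← f.counit_lin, ← g.counit_lin]; rfl⟩

end CoalgebraCategory


noncomputable section Functions

variable (n : ℕ) (M : Type*) [TopologicalSpace M] [ChartedSpace (EuclideanSpace ℝ (Fin n)) M]
  (𝕜 : Type) [RCLike 𝕜]

/-- The commutative ring (without identity, unless `M` is compact) of smooth `𝕜`-valued functions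
with compact support on a Hausdorff manifold `M`. -/
def Cc : NonUnitalSubring (M → 𝕜) where
  carrier := {f | ContMDiff (𝓡 n) 𝓘(ℝ, 𝕜) ∞ f ∧ HasCompactSupport f}
  zero_mem' := ⟨contMDiff_const, HasCompactSupport.zero⟩
  add_mem' hf hg := ⟨hf.1.add hg.1, hf.2.add hg.2⟩
  neg_mem' hf := ⟨contDiff_neg.contMDiff.comp hf.1, by
    have := hf.2
    simpa [HasCompactSupport, tsupport, Function.support_neg] using this⟩
  mul_mem' hf hg := ⟨by
    have h : ContDiff ℝ ∞ (fun p : 𝕜 × 𝕜 => p.1 * p.2) := contDiff_fst.mul contDiff_snd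
    exact h.contMDiff.comp (hf.1.prodMk_space hg.1), hf.2.mul_right⟩

variable {n M 𝕜}

theorem Cc.smooth (f : Cc n M 𝕜) : ContMDiff (𝓡 n) 𝓘(ℝ, 𝕜) ∞ f.1 := f.2.1
theorem Cc.compact (f : Cc n M 𝕜) : HasCompactSupport f.1 := f.2.2

@[simp] theorem Cc.add_apply (f g : Cc n M 𝕜) (x : M) : (f + g).1 x = f.1 x + g.1 x := rfl
@[simp] theorem Cc.sub_apply (f g : Cc n M 𝕜) (x : M) : (f - g).1 x = f.1 x - g.1 x := rfl
@[simp] theorem Cc.mul_apply (f g : Cc n M 𝕜) (x : M) : (f * g).1 x = f.1 x * g.1 x := rfl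
@[simp] theorem Cc.zero_apply (x : M) : (0 : Cc n M 𝕜).1 x = 0 := rfl

theorem Cc.eventually_zero (f : Cc n M 𝕜) {x : M} (hx : x ∉ tsupport f.1) :
    ∀ᶠ y in 𝓝 x, f.1 y = 0 := by
  filter_upwards [(isClosed_tsupport f.1).isOpen_compl.mem_nhds hx] with y hy
  exact image_eq_zero_of_notMem_tsupport hy

variable [IsManifold (𝓡 n) ∞ M] [T2Space M]

/-- Smooth bump functions. -/
theorem exists_bump (𝕜 : Type) [RCLike 𝕜] (x : M) {W : Set M} (hW : W ∈ 𝓝 x) :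
    ∃ f : Cc n M 𝕜, tsupport f.1 ⊆ W ∧ ∀ᶠ y in 𝓝 x, f.1 y = 1 := by
  obtain ⟨ψ, -, hψ⟩ := (SmoothBumpFunction.nhds_basis_tsupport (I := 𝓡 n) x).mem_iff.1 hW
  have hsub : tsupport (fun y => ((ψ y : ℝ) : 𝕜)) ⊆ tsupport ψ := by
    refine closure_mono fun y hy => ?_
    simpa using hy
  refine ⟨⟨fun y => ((ψ y : ℝ) : 𝕜), ?_, ?_⟩, hsub.trans hψ, ?_⟩
  · exact (RCLike.ofRealCLM (K := 𝕜)).contDiff.contMDiff.comp ψ.contMDiff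
  · exact ψ.hasCompactSupport.of_isClosed_subset (isClosed_tsupport _) hsub
  · filter_upwards [ψ.eventuallyEq_one] with y hy
    simp [hy]

/-- Smooth functions that equal one on a given compact set. -/
theorem exists_eq_one (𝕜 : Type) [RCLike 𝕜] {K W : Set M} (hK : IsCompact K) (hW : IsOpen W)
    (hKW : K ⊆ W) : ∃ f : Cc n M 𝕜, tsupport f.1 ⊆ W ∧ ∀ y ∈ K, f.1 y = 1 := by
  have h : ∃ f : Cc n M 𝕜, tsupport f.1 ⊆ W ∧ ∀ y ∈ K, f.1 y = 1 := by
    refine hK.induction_on (p := fun S => ∃ f : Cc n M 𝕜, tsupport f.1 ⊆ W ∧ ∀ y ∈ S, f.1 y = 1)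
      ?_ ?_ ?_ ?_
    · refine ⟨0, ?_, by simp⟩
      have : tsupport (0 : Cc n M 𝕜).1 = ∅ := by
        rw [tsupport_eq_empty_iff]; rfl
      rw [this]; exact Set.empty_subset _
    · rintro s t hst ⟨f, hf, hf'⟩
      exact ⟨f, hf, fun y hy => hf' y (hst hy)⟩
    · rintro s t ⟨f, hf, hf'⟩ ⟨g, hg, hg'⟩
      refine ⟨f + g - f * g, ?_, ?_⟩
      · refine (closure_minimal (t := tsupport f.1 ∪ tsupport g.1) ?_
          ((isClosed_tsupport _).union (isClosed_tsupport _))).trans (Set.union_subset hf hg)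
        intro y hy
        by_contra hc
        rw [Set.mem_union, not_or] at hc
        apply hy
        simp [image_eq_zero_of_notMem_tsupport hc.1, image_eq_zero_of_notMem_tsupport hc.2]
      · rintro y (hy | hy)
        · simp [hf' y hy]
        · simp [hg' y hy]
    · intro x hx
      obtain ⟨f, hf, hf1⟩ := exists_bump (n := n) 𝕜 x (hW.mem_nhds (hKW hx))
      exact ⟨_, mem_nhdsWithin_of_mem_nhds hf1, f, hf, fun y hy => hy⟩
  exact h

/-- Every `f` with support in an open set `W` has a local identity with support in `W`. -/
theorem exists_local_unit (f : Cc n M 𝕜) {W : Set M} (hW : IsOpen W) (hf : tsupport f.1 ⊆ W) :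
    ∃ η : Cc n M 𝕜, tsupport η.1 ⊆ W ∧ η * f = f := by
  obtain ⟨η, h1, h2⟩ := exists_eq_one (n := n) 𝕜 (Cc.compact f) hW hf
  refine ⟨η, h1, ?_⟩
  ext y
  by_cases hy : y ∈ tsupport f.1
  · simp [h2 y hy]
  · simp [image_eq_zero_of_notMem_tsupport hy]

end Functions


noncomputable section Etale

variable {n : ℕ} {M : Type u} [TopologicalSpace M] [ChartedSpace (EuclideanSpace ℝ (Fin n)) M]

/-! ### The smooth structure on the total space of a local homeomorphism -/

variable {E : Type*} [TopologicalSpace E] {π : E → M}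

/-- The charts of `M`, transported to `E` along a local homeomorphism `E → M`. -/
@[reducible] def etaleCharted (hπ : IsLocalHomeomorph π) :
    ChartedSpace (EuclideanSpace ℝ (Fin n)) E where
  atlas := {e | ∃ y : E, e = (hπ.localInverseAt y).symm.trans (chartAt _ (π y))}
  chartAt y := (hπ.localInverseAt y).symm.trans (chartAt _ (π y))
  mem_chart_source y := by simp
  chart_mem_atlas y := ⟨y, rfl⟩

theorem etale_isManifold [IsManifold (𝓡 n) ∞ M] (hπ : IsLocalHomeomorph π) :
    letI := etaleCharted (n := n) hπ
    IsManifold (𝓡 n) ∞ E := by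
  let _ := etaleCharted (n := n) hπ
  refine isManifold_of_contDiffOn (𝓡 n) ∞ E ?_
  rintro _ _ ⟨y, rfl⟩ ⟨y', rfl⟩
  have h := (contDiffGroupoid ∞ (𝓡 n)).compatible
    (chart_mem_atlas (EuclideanSpace ℝ (Fin n)) (π y))
    (chart_mem_atlas (EuclideanSpace ℝ (Fin n)) (π y'))
  rw [contDiffGroupoid, mem_groupoid_of_pregroupoid] at h
  refine (ContDiffOn.mono h.1 ?_).congr ?_
  all_goals
    intro z hz
    simp at hz
    have e1 : ∀ w ∈ (hπ.localInverseAt y).source, π (hπ.localInverseAt y w) = w :=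
      fun w hw => hπ.apply_localInverseAt_of_mem hw
    simp [hz, e1]
  grind

theorem etale_isLocalDiffeomorph [IsManifold (𝓡 n) ∞ M] (hπ : IsLocalHomeomorph π) :
    letI := etaleCharted (n := n) hπ
    IsLocalDiffeomorph (𝓡 n) (𝓡 n) ∞ π := by
  let _ := etaleCharted (n := n) hπ
  have _ := etale_isManifold (n := n) hπ
  intro y
  let c := chartAt (EuclideanSpace ℝ (Fin n)) (π y)
  let d := chartAt (EuclideanSpace ℝ (Fin n)) y
  have hd : d = (hπ.localInverseAt y).symm.trans c := rfl
  let g := d.trans c.symm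
  refine ⟨⟨g.toPartialEquiv, g.open_source, g.open_target, ?_, ?_⟩, ?_, ?_⟩
  · refine (contMDiffOn_chart_symm (n := ∞) (I := 𝓡 n) (x := π y)).comp
      ((contMDiffOn_chart (n := ∞) (I := 𝓡 n) (x := y)).mono ?_) ?_
    · intro z hz; exact hz.1
    · intro z hz; exact hz.2
  · refine (contMDiffOn_chart_symm (n := ∞) (I := 𝓡 n) (x := y)).comp
      ((contMDiffOn_chart (n := ∞) (I := 𝓡 n) (x := π y)).mono ?_) ?_
    · intro z hz; exact hz.1
    · intro z hz; exact hz.2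
  · exact ⟨mem_chart_source _ y, (d.map_source (mem_chart_source _ y)).1⟩
  · intro z hz
    change π z = c.symm (d z)
    have hz' : z ∈ d.source := hz.1
    simp [hd] at hz' ⊢
    rw [c.left_inv hz'.2]

end Etale

noncomputable section Sheaves

variable (n : ℕ) (M : Type u) [TopologicalSpace M] [ChartedSpace (EuclideanSpace ℝ (Fin n)) M]

/-- A sheaf (of sets) on `M`: a local diffeomorphism `π : E → M` from a (not necessarily Hausdorff)
manifold `E`. -/
structure Sh where
  Total : Type u
  [topologicalSpace : TopologicalSpace Total]
  [chartedSpace : ChartedSpace (EuclideanSpace ℝ (Fin n)) Total]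
  [isManifold : IsManifold (𝓡 n) ∞ Total]
  proj : Total → M
  isLocalDiffeomorph : IsLocalDiffeomorph (𝓡 n) (𝓡 n) ∞ proj

attribute [instance] Sh.topologicalSpace Sh.chartedSpace Sh.isManifold

variable {n M}

/-- Morphisms of sheaves: smooth maps over `M`. -/
@[ext] structure Sh.Hom (E F : Sh n M) where
  toFun : E.Total → F.Total
  smooth : ContMDiff (𝓡 n) (𝓡 n) ∞ toFun
  proj_toFun : ∀ y, F.proj (toFun y) = E.proj y

/-- The category of sheaves on `M`. -/
instance : Category (Sh n M) where
  Hom E F := Sh.Hom E F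
  id E := ⟨fun y => y, contMDiff_id, fun _ => rfl⟩
  comp f g := ⟨fun y => g.toFun (f.toFun y), g.smooth.comp f.smooth,
    fun y => by rw [g.proj_toFun, f.proj_toFun]⟩

theorem Sh.isLocalHomeomorph (E : Sh n M) : IsLocalHomeomorph E.proj :=
  E.isLocalDiffeomorph.isLocalHomeomorph

theorem Sh.Hom.isLocalHomeomorph {E F : Sh n M} (φ : Sh.Hom E F) :
    IsLocalHomeomorph φ.toFun := by
  refine IsLocalHomeomorph.of_comp (g := F.proj) ?_ F.isLocalHomeomorph φ.smooth.continuous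
  have : F.proj ∘ φ.toFun = E.proj := funext φ.proj_toFun
  rw [this]; exact E.isLocalHomeomorph

/-- A continuous map over `M` between sheaves is smooth. -/
def Sh.homOfContinuous {E F : Sh n M} (φ : E.Total → F.Total) (hφ : Continuous φ)
    (h : ∀ y, F.proj (φ y) = E.proj y) : Sh.Hom E F where
  toFun := φ
  smooth := by
    intro y
    obtain ⟨Φ, hy, he⟩ := F.isLocalDiffeomorph (φ y)
    have hU : ∀ᶠ z in 𝓝 y, φ z ∈ Φ.source :=
      hφ.continuousAt.eventually (Φ.open_source.mem_nhds hy)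
    have h1 : φ =ᶠ[𝓝 y] Φ.invFun ∘ E.proj := by
      filter_upwards [hU] with z hz
      have : Φ.toFun (φ z) = E.proj z := by rw [← h z]; exact (he hz).symm
      change φ z = Φ.invFun (E.proj z)
      rw [← this]
      exact (Φ.left_inv' hz).symm
    refine ContMDiffAt.congr_of_eventuallyEq ?_ h1
    refine ContMDiffAt.comp y ?_ E.isLocalDiffeomorph.contMDiff.contMDiffAt
    refine Φ.contMDiffOn_invFun.contMDiffAt (Φ.open_target.mem_nhds ?_)
    have : Φ.toFun (φ y) = E.proj y := by rw [← h y]; exact (he hy).symm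
    rw [← this]
    exact Φ.map_source' hy
  proj_toFun := h

/-- The sheaf on `M` given by a local homeomorphism, with the unique smooth structure for which
it is a local diffeomorphism. -/
def Sh.ofEtale [IsManifold (𝓡 n) ∞ M] {E : Type u} [TopologicalSpace E] (π : E → M)
    (hπ : IsLocalHomeomorph π) : Sh n M :=
  letI := etaleCharted (n := n) hπ
  haveI := etale_isManifold (n := n) hπ
  { Total := E, proj := π, isLocalDiffeomorph := etale_isLocalDiffeomorph hπ }

/-- A continuous, open, locally injective map is a local homeomorphism. -/
theorem isLocalHomeomorph_of_open {X Y : Type*} [TopologicalSpace X] [TopologicalSpace Y]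
    {f : X → Y} (hc : Continuous f) (ho : IsOpenMap f)
    (hi : ∀ x, ∃ U : Set X, IsOpen U ∧ x ∈ U ∧ Set.InjOn f U) : IsLocalHomeomorph f := by
  rw [isLocalHomeomorph_iff_isOpenEmbedding_restrict]
  intro x
  obtain ⟨U, hU, hx, hinj⟩ := hi x
  exact ⟨U, hU.mem_nhds hx, Topology.IsOpenEmbedding.of_continuous_injective_isOpenMap
    (hc.comp continuous_subtype_val) hinj.injective (ho.domRestrict hU)⟩

/-- The underlying space of the fibred product `E ×_M F`. -/
abbrev Sh.FibreProd (E F : Sh n M) : Type u :=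
  {p : E.Total × F.Total // E.proj p.1 = F.proj p.2}

theorem Sh.fibreProd_isLocalHomeomorph (E F : Sh n M) :
    IsLocalHomeomorph (fun p : Sh.FibreProd E F => E.proj p.1.1) := by
  have hE := E.isLocalHomeomorph
  have hF := F.isLocalHomeomorph
  refine isLocalHomeomorph_of_open
    (hE.continuous.comp (continuous_fst.comp continuous_subtype_val)) ?_ ?_
  · rw [isOpenMap_iff_nhds_le]
    rintro ⟨⟨y, z⟩, h⟩ S hS
    obtain ⟨T, hT, hTS⟩ := (mem_nhds_subtype _ _ _).1 hS
    have hT' : T ∈ 𝓝 y ×ˢ 𝓝 z := by rwa [← nhds_prod_eq]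
    obtain ⟨T1, h1, T2, h2, h12⟩ := Filter.mem_prod_iff.1 hT'
    have hs : Tendsto (hE.localInverseAt y) (𝓝 (E.proj y)) (𝓝 y) := by
      have := (hE.localInverseAt y).continuousAt hE.apply_self_mem_localInverseAt_source
      simpa [ContinuousAt] using this
    have ht : Tendsto (hF.localInverseAt z) (𝓝 (E.proj y)) (𝓝 z) := by
      have := (hF.localInverseAt z).continuousAt hF.apply_self_mem_localInverseAt_source
      rw [show E.proj y = F.proj z from h]
      simpa [ContinuousAt] using this
    have m1 : (hE.localInverseAt y).source ∈ 𝓝 (E.proj y) :=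
      (hE.localInverseAt y).open_source.mem_nhds hE.apply_self_mem_localInverseAt_source
    have m2 : (hF.localInverseAt z).source ∈ 𝓝 (E.proj y) := by
      rw [show E.proj y = F.proj z from h]
      exact (hF.localInverseAt z).open_source.mem_nhds hF.apply_self_mem_localInverseAt_source
    change S ∈ 𝓝 (E.proj y)
    filter_upwards [hs h1, ht h2, m1, m2] with x hx1 hx2 hx3 hx4
    have e1 := hE.apply_localInverseAt_of_mem hx3
    have e2 := hF.apply_localInverseAt_of_mem hx4
    have := @hTS ⟨⟨hE.localInverseAt y x, hF.localInverseAt z x⟩, e1.trans e2.symm⟩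
      (h12 ⟨hx1, hx2⟩)
    change E.proj (hE.localInverseAt y x) ∈ S at this
    rwa [e1] at this
  · rintro ⟨⟨y, z⟩, h⟩
    refine ⟨{p | p.1.1 ∈ (hE.localInverseAt y).target ∧ p.1.2 ∈ (hF.localInverseAt z).target},
      ?_, ⟨by simp, by simp⟩, ?_⟩
    · exact ((hE.localInverseAt y).open_target.preimage
        (continuous_fst.comp continuous_subtype_val)).inter
        ((hF.localInverseAt z).open_target.preimage (continuous_snd.comp continuous_subtype_val))
    · rintro ⟨⟨a, b⟩, hab⟩ ⟨ha, hb⟩ ⟨⟨a', b'⟩, hab'⟩ ⟨ha', hb'⟩ heq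
      have e1 : a = a' := hE.injOn_localInverseAt_target ha ha' heq
      have e2 : b = b' := hF.injOn_localInverseAt_target hb hb' (by
        rw [← show E.proj a = F.proj b from hab, ← show E.proj a' = F.proj b' from hab']
        exact heq)
      subst e1 e2; rfl

variable [IsManifold (𝓡 n) ∞ M]

/-- The fibred product `E ×_M F` of two sheaves on `M`, as a sheaf on `M`. -/
def Sh.prod (E F : Sh n M) : Sh n M :=
  Sh.ofEtale (fun p : Sh.FibreProd E F => E.proj p.1.1) (Sh.fibreProd_isLocalHomeomorph E F)

/-- The diagonal `E → E ×_M E`. -/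
def Sh.diag (E : Sh n M) : Sh.Hom E (E.prod E) :=
  Sh.homOfContinuous (F := E.prod E) (fun y => (⟨(y, y), rfl⟩ : Sh.FibreProd E E))
    ((continuous_id.prodMk continuous_id).subtype_mk _) (fun _ => rfl)

end Sheaves


noncomputable section SheafFunctions

open scoped Classical in
/-- The extension by zero `f|_U^E` of `f : U → 𝕜`, as a section of germs on `E`. -/
def extGerm {E 𝕜 : Type*} [TopologicalSpace E] [Zero 𝕜] (U : Set E) (f : U → 𝕜) :
    ∀ y : E, Germ (𝓝 y) 𝕜 :=
  fun y => if y ∈ U then ((Function.extend Subtype.val f 0 : E → 𝕜) : Germ (𝓝 y) 𝕜) else 0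

/-- The smooth functions with compact support on a not necessarily Hausdorff manifold `E`: the sums
of extensions by zero of smooth functions with compact support in Hausdorff open subsets of `E`,
inside the (not necessarily continuous) sections of germs of functions on `E`. -/
def CcSec (n : ℕ) (E : Type*) [TopologicalSpace E] [ChartedSpace (EuclideanSpace ℝ (Fin n)) E]
    (𝕜 : Type) [RCLike 𝕜] : AddSubgroup (∀ y : E, Germ (𝓝 y) 𝕜) :=
  AddSubgroup.closure {u | ∃ (U : TopologicalSpace.Opens E) (f : Cc n U 𝕜),
    T2Space U ∧ u = extGerm (U : Set E) f.1}

/-- The pushforward `φ_{*y}` of germs along a local homeomorphism (inverse to the pullback). -/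
def pushGerm {E F 𝕜 : Type*} [TopologicalSpace E] [TopologicalSpace F] {φ : E → F}
    (hφ : IsLocalHomeomorph φ) {y : E} {z : F} (h : φ y = z) (g : Germ (𝓝 y) 𝕜) :
    Germ (𝓝 z) 𝕜 :=
  g.compTendsto (hφ.localInverseAt y) (by
    have := (hφ.localInverseAt y).continuousAt hφ.apply_self_mem_localInverseAt_source
    subst h
    simpa [ContinuousAt] using this)

/-- The pushforward `φ_+(u)_z = ∑_{y ∈ φ⁻¹(z)} φ_{*y}(u_y)`. -/
def pushSec {E F 𝕜 : Type*} [TopologicalSpace E] [TopologicalSpace F] [AddCommMonoid 𝕜]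
    {φ : E → F} (hφ : IsLocalHomeomorph φ) (u : ∀ y : E, Germ (𝓝 y) 𝕜) :
    ∀ z : F, Germ (𝓝 z) 𝕜 :=
  fun z => ∑ᶠ y : {y : E // φ y = z}, pushGerm hφ y.2 (u y.1)

section Germs

variable {E F 𝕜 : Type*} [TopologicalSpace E] [TopologicalSpace F] {φ : E → F}

theorem pushGerm_comp (hφ : IsLocalHomeomorph φ) {y : E} {z : F} (h : φ y = z) (f : F → 𝕜) :
    pushGerm hφ h ((f ∘ φ : E → 𝕜) : Germ (𝓝 y) 𝕜) = (f : Germ (𝓝 z) 𝕜) := by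
  subst h
  refine Quotient.sound ?_
  change ∀ᶠ x in 𝓝 (φ y), (f ∘ φ) (hφ.localInverseAt y x) = f x
  filter_upwards [(hφ.localInverseAt y).open_source.mem_nhds
    hφ.apply_self_mem_localInverseAt_source] with x hx
  simp [hφ.apply_localInverseAt_of_mem hx]

theorem pushGerm_zero [Zero 𝕜] (hφ : IsLocalHomeomorph φ) {y : E} {z : F} (h : φ y = z) :
    pushGerm hφ h (0 : Germ (𝓝 y) 𝕜) = 0 := rfl

theorem pushGerm_add [Add 𝕜] (hφ : IsLocalHomeomorph φ) {y : E} {z : F} (h : φ y = z)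
    (g g' : Germ (𝓝 y) 𝕜) : pushGerm hφ h (g + g') = pushGerm hφ h g + pushGerm hφ h g' := by
  induction g using Germ.inductionOn with | _ g =>
  induction g' using Germ.inductionOn with | _ g' =>
  rfl

end Germs

variable {n : ℕ} {M : Type u} [TopologicalSpace M] [ChartedSpace (EuclideanSpace ℝ (Fin n)) M]
  {𝕜 : Type} [RCLike 𝕜]

/-! ### Functions supported in elementary subsets -/

open scoped Classical in
/-- The extension by zero of `f ∘ π|_U`. -/
def el (E : Sh n M) (U : Set E.Total) (f : Cc n M 𝕜) : ∀ y : E.Total, Germ (𝓝 y) 𝕜 :=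
  fun y => if y ∈ U then ((f.1 ∘ E.proj : E.Total → 𝕜) : Germ (𝓝 y) 𝕜) else 0

/-- `U` is elementary and `f` has support in the image of `U`. -/
structure IsEl (E : Sh n M) (U : Set E.Total) (f : Cc n M 𝕜) : Prop where
  isOpen : IsOpen U
  injOn : Set.InjOn E.proj U
  supp : tsupport f.1 ⊆ E.proj '' U

theorem el_mem {E : Sh n M} {U : Set E.Total} (f : Cc n M 𝕜) {y : E.Total} (hy : y ∈ U) :
    el E U f y = ((f.1 ∘ E.proj : E.Total → 𝕜) : Germ (𝓝 y) 𝕜) := if_pos hy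

theorem el_not_mem {E : Sh n M} {U : Set E.Total} (f : Cc n M 𝕜) {y : E.Total} (hy : y ∉ U) :
    el E U f y = 0 := if_neg hy

/-- Elementary neighbourhoods exist. -/
theorem exists_elementary (E : Sh n M) (y : E.Total) :
    ∃ U : Set E.Total, IsOpen U ∧ y ∈ U ∧ Set.InjOn E.proj U :=
  ⟨(E.isLocalHomeomorph.localInverseAt y).target,
    (E.isLocalHomeomorph.localInverseAt y).open_target, by simp,
    E.isLocalHomeomorph.injOn_localInverseAt_target⟩

theorem IsEl.el_mem_CcSec [T2Space M] {E : Sh n M} {U : Set E.Total} {f : Cc n M 𝕜}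
    (h : IsEl E U f) : el E U f ∈ CcSec n E.Total 𝕜 := by
  let V : TopologicalSpace.Opens E.Total := ⟨U, h.isOpen⟩
  let q : V → M := fun y => E.proj y.1
  have hq : Topology.IsOpenEmbedding q :=
    Topology.IsOpenEmbedding.of_continuous_injective_isOpenMap
      (E.isLocalHomeomorph.continuous.comp continuous_subtype_val) h.injOn.injective
      (E.isLocalHomeomorph.isOpenMap.domRestrict h.isOpen)
  have hsupp : tsupport (f.1 ∘ q) = q ⁻¹' tsupport f.1 := by
    rw [tsupport, tsupport, hq.isOpenMap.preimage_closure_eq_closure_preimage hq.continuous]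
    rfl
  have hV : T2Space V := hq.isEmbedding.t2Space
  let g : Cc n V 𝕜 := ⟨f.1 ∘ q, by
    refine ⟨(Cc.smooth f).comp (E.isLocalDiffeomorph.contMDiff.comp contMDiff_subtype_val), ?_⟩
    rw [HasCompactSupport, hsupp]
    refine hq.isInducing.isCompact_preimage_iff ?_ |>.2 (Cc.compact f)
    intro x hx
    obtain ⟨y, hy, rfl⟩ := h.supp hx
    exact ⟨⟨y, hy⟩, rfl⟩⟩
  refine AddSubgroup.subset_closure ⟨V, g, hV, ?_⟩
  funext y
  by_cases hy : y ∈ U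
  · rw [el_mem f hy, extGerm, if_pos (show y ∈ (V : Set E.Total) from hy)]
    refine Quotient.sound ?_
    filter_upwards [h.isOpen.mem_nhds hy] with w hw
    exact (Subtype.val_injective.extend_apply g.1 0 (⟨w, hw⟩ : V)).symm
  · rw [el_not_mem f hy, extGerm, if_neg (show y ∉ (V : Set E.Total) from hy)]

open scoped Classical in
/-- A function supported in an elementary subset comes from a function on the base. -/
theorem exists_el_of_supp [T2Space M] {E : Sh n M} {U : TopologicalSpace.Opens E.Total}
    (f : Cc n U 𝕜) {V : Set E.Total} (hV : IsOpen V) (hinj : Set.InjOn E.proj V)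
    (hVU : V ⊆ U) (hf : Subtype.val '' tsupport f.1 ⊆ V) :
    ∃ F : Cc n M 𝕜, IsEl E V F ∧ extGerm (U : Set E.Total) f.1 = el E V F := by
  set K : Set E.Total := Subtype.val '' tsupport f.1 with hK
  have hKc : IsCompact K := (Cc.compact f).isCompact.image continuous_subtype_val
  set g : E.Total → 𝕜 := Function.extend Subtype.val f.1 0 with hg
  have hgU : ∀ y : U, g y.1 = f.1 y := fun y => Subtype.val_injective.extend_apply f.1 0 y
  have hgK : ∀ y, y ∉ K → g y = 0 := by
    intro y hy
    by_cases hyU : y ∈ U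
    · rw [hgU ⟨y, hyU⟩]
      exact image_eq_zero_of_notMem_tsupport fun hc => hy ⟨_, hc, rfl⟩
    · exact Function.extend_apply' _ _ _ (by rintro ⟨a, rfl⟩; exact hyU a.2)
  let F : M → 𝕜 := fun x => if h : ∃ y ∈ V, E.proj y = x then g h.choose else 0
  have hF : ∀ y ∈ V, F (E.proj y) = g y := by
    intro y hy
    have h : ∃ y' ∈ V, E.proj y' = E.proj y := ⟨y, hy, rfl⟩
    simp only [F, dif_pos h]
    rw [hinj h.choose_spec.1 hy h.choose_spec.2]
  have hF0 : ∀ x, x ∉ E.proj '' K → F x = 0 := by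
    intro x hx
    by_cases h : ∃ y ∈ V, E.proj y = x
    · obtain ⟨y, hy, rfl⟩ := h
      rw [hF y hy]
      exact hgK y fun hc => hx ⟨y, hc, rfl⟩
    · simp only [F, dif_neg h]
  have hKc' : IsCompact (E.proj '' K) := hKc.image E.isLocalHomeomorph.continuous
  have hts : tsupport F ⊆ E.proj '' K := by
    refine closure_minimal (fun x hx => ?_) hKc'.isClosed
    by_contra hc
    exact hx (hF0 x hc)
  have hFs : ContMDiff (𝓡 n) 𝓘(ℝ, 𝕜) ∞ F := by
    refine contMDiff_of_tsupport fun x hx => ?_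
    obtain ⟨y, hy, rfl⟩ := hts hx
    obtain ⟨Φ, hyΦ, he⟩ := E.isLocalDiffeomorph y
    have hΦy : Φ.toFun y = E.proj y := (he hyΦ).symm
    have hyt : E.proj y ∈ Φ.target := hΦy ▸ Φ.map_source' hyΦ
    have hinv : Φ.invFun (E.proj y) = y := by rw [← hΦy]; exact Φ.left_inv' hyΦ
    have hsm : ContMDiffAt (𝓡 n) (𝓡 n) ∞ Φ.invFun (E.proj y) :=
      Φ.contMDiffOn_invFun.contMDiffAt (Φ.open_target.mem_nhds hyt)
    have hgs : ContMDiffAt (𝓡 n) 𝓘(ℝ, 𝕜) ∞ g (Φ.invFun (E.proj y)) := by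
      rw [hinv]
      refine (contMDiffAt_subtype_iff (U := U) (x := ⟨y, hVU (hf hy)⟩)).1 ?_
      have : (fun x : U => g x) = f.1 := funext hgU
      rw [this]
      exact (Cc.smooth f).contMDiffAt
    refine (hgs.comp (E.proj y) hsm).congr_of_eventuallyEq ?_
    have hVn : ∀ᶠ x in 𝓝 (E.proj y), Φ.invFun x ∈ V := by
      refine hsm.continuousAt.eventually (hV.mem_nhds ?_)
      rw [hinv]; exact hf hy
    filter_upwards [hVn, Φ.open_target.mem_nhds hyt] with x hx hxt
    have h1 : Φ.invFun x ∈ Φ.source := Φ.map_target' hxt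
    have h2 : E.proj (Φ.invFun x) = x := (he h1).trans (Φ.right_inv' hxt)
    have := hF _ hx
    rw [h2] at this
    exact this
  refine ⟨⟨F, hFs, hKc'.of_isClosed_subset (isClosed_tsupport _) hts⟩,
    ⟨hV, hinj, hts.trans (Set.image_mono hf)⟩, ?_⟩
  funext y
  by_cases hy : y ∈ V
  · rw [el_mem _ hy, extGerm, if_pos (show y ∈ (U : Set E.Total) from hVU hy)]
    refine Quotient.sound ?_
    filter_upwards [hV.mem_nhds hy] with w hw
    exact (hF w hw).symm
  · rw [el_not_mem _ hy, extGerm]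
    by_cases hyU : y ∈ (U : Set E.Total)
    · rw [if_pos hyU]
      have h1 : (⟨y, hyU⟩ : U) ∉ tsupport f.1 := fun hc => hy (hf ⟨_, hc, rfl⟩)
      have h2 := Cc.eventually_zero f h1
      refine Quotient.sound ?_
      have h3 : ∀ᶠ w in 𝓝 y, ∀ hw : w ∈ U, f.1 ⟨w, hw⟩ = 0 := by
        rw [nhds_subtype_eq_comap, eventually_comap] at h2
        filter_upwards [h2] with w hw hwU
        exact hw ⟨w, hwU⟩ rfl
      filter_upwards [h3, U.2.mem_nhds hyU] with w hw hwU
      change g w = 0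
      rw [← hw hwU]
      exact hgU ⟨w, hwU⟩
    · rw [if_neg hyU]


theorem extGerm_add {E : Type*} [TopologicalSpace E] (U : Set E) (f g : U → 𝕜) :
    extGerm U (f + g) = extGerm U f + extGerm U g := by
  funext y
  by_cases hy : y ∈ U
  · simp only [extGerm, if_pos hy, Pi.add_apply]
    rw [← Germ.coe_add, ← Function.extend_add, add_zero]
  · simp [extGerm, if_neg hy]

theorem extGerm_neg {E : Type*} [TopologicalSpace E] (U : Set E) (f : U → 𝕜) :
    extGerm U (-f) = - extGerm U f := by
  funext y
  by_cases hy : y ∈ U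
  · simp only [extGerm, if_pos hy, Pi.neg_apply]
    rw [← Germ.coe_neg, ← Function.extend_neg, neg_zero]
  · simp [extGerm, if_neg hy]

theorem el_neg (E : Sh n M) (U : Set E.Total) (f : Cc n M 𝕜) : el E U (-f) = - el E U f := by
  funext y
  by_cases hy : y ∈ U
  · rw [Pi.neg_apply, el_mem _ hy, el_mem _ hy]; rfl
  · rw [Pi.neg_apply, el_not_mem _ hy, el_not_mem _ hy, neg_zero]

theorem IsEl.neg {E : Sh n M} {U : Set E.Total} {f : Cc n M 𝕜} (h : IsEl E U f) :
    IsEl E U (-f) := by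
  refine ⟨h.isOpen, h.injOn, ?_⟩
  have : tsupport (-f).1 = tsupport f.1 := by
    change tsupport (-(f.1)) = _
    simp [tsupport, Function.support_neg]
  rw [this]; exact h.supp

/-- The functions supported in elementary subsets span all the functions. -/
theorem CcSec_eq [T2Space M] (E : Sh n M) : CcSec n E.Total 𝕜 =
    AddSubgroup.closure {u | ∃ (U : Set E.Total) (f : Cc n M 𝕜), IsEl E U f ∧ u = el E U f} := by
  refine le_antisymm ?_ ?_
  · refine (AddSubgroup.closure_le _).2 ?_
    rintro _ ⟨U, f, hU, rfl⟩
    set S := AddSubgroup.closure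
      {u | ∃ (U : Set E.Total) (f : Cc n M 𝕜), IsEl E U f ∧ u = el E U f} with hS
    have key : ∃ ρ : Cc n U 𝕜, (∀ y ∈ tsupport f.1, ρ.1 y = 1) ∧
        ∀ g : Cc n U 𝕜, extGerm (U : Set E.Total) (ρ * g).1 ∈ S := by
      refine (Cc.compact f).isCompact.induction_on
        (p := fun K => ∃ ρ : Cc n U 𝕜, (∀ y ∈ K, ρ.1 y = 1) ∧
          ∀ g : Cc n U 𝕜, extGerm (U : Set E.Total) (ρ * g).1 ∈ S) ?_ ?_ ?_ ?_
      · refine ⟨0, by simp, fun g => ?_⟩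
        rw [zero_mul]
        convert S.zero_mem
        have := extGerm_add (U : Set E.Total) (0 : U → 𝕜) 0
        simpa using this
      · rintro s t hst ⟨ρ, h1, h2⟩
        exact ⟨ρ, fun y hy => h1 y (hst hy), h2⟩
      · rintro s t ⟨ρ, h1, h2⟩ ⟨σ, h3, h4⟩
        refine ⟨ρ + σ - ρ * σ, ?_, fun g => ?_⟩
        · rintro y (hy | hy)
          · simp [h1 y hy]
          · simp [h3 y hy]
        · have e : ((ρ + σ - ρ * σ) * g).1 = (ρ * g).1 + (σ * g).1 + -(ρ * (σ * g)).1 := by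
            funext y
            simp
            ring
          rw [e, extGerm_add, extGerm_add, extGerm_neg]
          exact S.add_mem (S.add_mem (h2 g) (h4 g)) (S.neg_mem (h2 _))
      · intro x hx
        obtain ⟨V, hV, hxV, hinj⟩ := exists_elementary E x.1
        obtain ⟨ρ, h1, h2⟩ := exists_bump (n := n) 𝕜 x
          ((hV.preimage continuous_subtype_val).mem_nhds hxV)
        refine ⟨_, mem_nhdsWithin_of_mem_nhds h2, ρ, fun y hy => hy, fun g => ?_⟩
        obtain ⟨F, hF, hF'⟩ := exists_el_of_supp (E := E) (ρ * g) (hV.inter U.2)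
          (hinj.mono Set.inter_subset_left) Set.inter_subset_right (by
            rintro _ ⟨y, hy, rfl⟩
            refine ⟨h1 (closure_mono ?_ hy), y.2⟩
            intro z hz
            simp only [Function.mem_support, Cc.mul_apply] at hz
            exact left_ne_zero_of_mul hz)
        rw [hF']
        exact AddSubgroup.subset_closure ⟨_, F, hF, rfl⟩
    obtain ⟨ρ, h1, h2⟩ := key
    have : ρ * f = f := by
      ext y
      by_cases hy : y ∈ tsupport f.1
      · simp [h1 y hy]
      · simp [image_eq_zero_of_notMem_tsupport hy]
    have h3 := h2 f
    rwa [this] at h3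
  · refine (AddSubgroup.closure_le _).2 ?_
    rintro _ ⟨U, f, h, rfl⟩
    exact h.el_mem_CcSec

variable [T2Space M]

variable (𝕜) in
/-- The smooth functions with compact support on the total space of a sheaf `E` on `M`. -/
def Sh.Fn (E : Sh n M) : Type u := CcSec n E.Total 𝕜

instance (E : Sh n M) : AddCommGroup (E.Fn 𝕜) :=
  inferInstanceAs (AddCommGroup (CcSec n E.Total 𝕜))

/-- The section of germs underlying an element of `E.Fn 𝕜`. -/
def Sh.Fn.sec {E : Sh n M} : E.Fn 𝕜 →+ (∀ y : E.Total, Germ (𝓝 y) 𝕜) :=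
  (CcSec n E.Total 𝕜).subtype

theorem Sh.Fn.ext {E : Sh n M} {u v : E.Fn 𝕜} (h : u.sec = v.sec) : u = v := Subtype.ext h

theorem Sh.Fn.sec_mem {E : Sh n M} (u : E.Fn 𝕜) : u.sec ∈ CcSec n E.Total 𝕜 := u.2

/-- `f ∘ π|_U` as an element of `E.Fn 𝕜`. -/
def elF {E : Sh n M} {U : Set E.Total} {f : Cc n M 𝕜} (h : IsEl E U f) : E.Fn 𝕜 :=
  ⟨el E U f, h.el_mem_CcSec⟩

@[simp] theorem elF_sec {E : Sh n M} {U : Set E.Total} {f : Cc n M 𝕜} (h : IsEl E U f) :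
    (elF h).sec = el E U f := rfl

theorem Sh.Fn.induction {E : Sh n M} {p : E.Fn 𝕜 → Prop} (u : E.Fn 𝕜) (h0 : p 0)
    (hel : ∀ (U : Set E.Total) (f : Cc n M 𝕜) (h : IsEl E U f), p (elF h))
    (hadd : ∀ u v, p u → p v → p (u + v)) : p u := by
  have key : ∀ v ∈ CcSec n E.Total 𝕜, ∃ hv : v ∈ CcSec n E.Total 𝕜, p ⟨v, hv⟩ := by
    intro v hv
    rw [CcSec_eq, ← AddSubgroup.mem_toAddSubmonoid, AddSubgroup.closure_toAddSubmonoid] at hv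
    induction hv using AddSubmonoid.closure_induction with
    | mem v hv =>
      rcases hv with ⟨U, f, h, rfl⟩ | ⟨U, f, h, hv⟩
      · exact ⟨_, hel U f h⟩
      · have e : v = el E U (-f) := by rw [el_neg, ← hv, neg_neg]
        subst e
        exact ⟨_, hel U (-f) h.neg⟩
    | zero => exact ⟨zero_mem _, h0⟩
    | add v w _ _ hv hw =>
      obtain ⟨hv, hpv⟩ := hv
      obtain ⟨hw, hpw⟩ := hw
      exact ⟨add_mem hv hw, hadd _ _ hpv hpw⟩
  exact (key u.1 u.2).2

/-- The section of germs `p u`, `(p u)_y = π^*_y(p_{π(y)}) u_y`. -/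
def smulSec (E : Sh n M) (p : Cc n M 𝕜) (u : ∀ y : E.Total, Germ (𝓝 y) 𝕜) :
    ∀ y : E.Total, Germ (𝓝 y) 𝕜 :=
  fun y => ((p.1 ∘ E.proj : E.Total → 𝕜) : Germ (𝓝 y) 𝕜) * u y

theorem smulSec_add (E : Sh n M) (p : Cc n M 𝕜) (u v : ∀ y : E.Total, Germ (𝓝 y) 𝕜) :
    smulSec E p (u + v) = smulSec E p u + smulSec E p v := funext fun _ => mul_add _ _ _

theorem smulSec_el (E : Sh n M) (p : Cc n M 𝕜) (U : Set E.Total) (f : Cc n M 𝕜) :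
    smulSec E p (el E U f) = el E U (p * f) := by
  funext y
  by_cases hy : y ∈ U
  · rw [smulSec, el_mem _ hy, el_mem _ hy]; rfl
  · rw [smulSec, el_not_mem _ hy, el_not_mem _ hy, mul_zero]

theorem IsEl.mul {E : Sh n M} {U : Set E.Total} {f : Cc n M 𝕜} (h : IsEl E U f)
    (p : Cc n M 𝕜) : IsEl E U (p * f) := by
  refine ⟨h.isOpen, h.injOn, (closure_mono fun y hy => ?_).trans h.supp⟩
  simp only [Function.mem_support, Cc.mul_apply] at hy
  exact right_ne_zero_of_mul hy

theorem smulSec_mem (E : Sh n M) (p : Cc n M 𝕜) (u : E.Fn 𝕜) :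
    smulSec E p u.sec ∈ CcSec n E.Total 𝕜 := by
  induction u using Sh.Fn.induction with
  | h0 =>
    have := smulSec_add E p 0 0
    rw [map_zero]
    simp only [add_zero, left_eq_add] at this
    rw [this]; exact zero_mem _
  | hel U f h => rw [elF_sec, smulSec_el]; exact (h.mul p).el_mem_CcSec
  | hadd u v hu hv => rw [map_add, smulSec_add]; exact add_mem hu hv

/-- The module structure of `C_c^∞(E)` over `C_c^∞(M)`. -/
instance (E : Sh n M) : NUModule (Cc n M 𝕜) (E.Fn 𝕜) where
  smul p u := ⟨smulSec E p u.sec, smulSec_mem E p u⟩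
  smul_add' p u v := Sh.Fn.ext (smulSec_add E p u.sec v.sec)
  add_smul' p q u := Sh.Fn.ext (funext fun y => add_mul
    ((p.1 ∘ E.proj : E.Total → 𝕜) : Germ (𝓝 y) 𝕜) ((q.1 ∘ E.proj : E.Total → 𝕜) : Germ (𝓝 y) 𝕜)
    (u.sec y))
  mul_smul' p q u := Sh.Fn.ext (funext fun y => mul_assoc
    ((p.1 ∘ E.proj : E.Total → 𝕜) : Germ (𝓝 y) 𝕜) ((q.1 ∘ E.proj : E.Total → 𝕜) : Germ (𝓝 y) 𝕜)
    (u.sec y))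

theorem Sh.Fn.smul_sec {E : Sh n M} (p : Cc n M 𝕜) (u : E.Fn 𝕜) :
    (p • u).sec = smulSec E p u.sec := rfl

theorem smul_elF {E : Sh n M} {U : Set E.Total} {f : Cc n M 𝕜} (h : IsEl E U f)
    (p : Cc n M 𝕜) : p • elF h = elF (h.mul p) := Sh.Fn.ext (smulSec_el E p U f)

theorem elF_congr {E : Sh n M} {U V : Set E.Total} {f g : Cc n M 𝕜} (h : IsEl E U f)
    (h' : IsEl E V g) (hU : U = V) (hf : f = g) : elF h = elF h' := by
  subst hU hf; rfl


/-! ### Pushforward along morphisms, and the counit -/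

theorem Sh.Fn.finite_fibre {E : Sh n M} (u : E.Fn 𝕜) (x : M) :
    {y | E.proj y = x ∧ u.sec y ≠ 0}.Finite := by
  induction u using Sh.Fn.induction with
  | h0 => simp
  | hel U f h =>
    refine Set.Subsingleton.finite ?_
    rintro y ⟨hy, hy'⟩ z ⟨hz, hz'⟩
    have h1 : y ∈ U := by
      by_contra hc
      exact hy' (el_not_mem f hc)
    have h2 : z ∈ U := by
      by_contra hc
      exact hz' (el_not_mem f hc)
    exact h.injOn h1 h2 (hy.trans hz.symm)
  | hadd u v hu hv =>
    refine (hu.union hv).subset ?_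
    rintro y ⟨hy, hy'⟩
    by_contra hc
    simp only [Set.mem_union, Set.mem_ofPred_eq, hy, true_and, not_or, not_not] at hc
    apply hy'
    rw [map_add, Pi.add_apply, hc.1, hc.2, add_zero]

section Push

variable {E : Sh n M} {Y : Type*} [TopologicalSpace Y] {φ : E.Total → Y}

theorem push_finite (hφ : IsLocalHomeomorph φ) (hfib : ∀ y y', φ y = φ y' → E.proj y = E.proj y')
    (u : E.Fn 𝕜) (z : Y) :
    (Function.support fun y : {y : E.Total // φ y = z} => pushGerm hφ y.2 (u.sec y.1)).Finite := by
  by_cases hz : ∃ y₀, φ y₀ = z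
  · obtain ⟨y₀, rfl⟩ := hz
    refine Set.Finite.of_finite_image (f := Subtype.val) ?_ Subtype.val_injective.injOn
    refine (u.finite_fibre (E.proj y₀)).subset ?_
    rintro _ ⟨y, hy, rfl⟩
    refine ⟨hfib _ _ y.2, fun h => hy ?_⟩
    simp only [h]
    exact pushGerm_zero hφ y.2
  · refine Set.Finite.subset Set.finite_empty ?_
    rintro ⟨y, hy⟩ -
    exact hz ⟨y, hy⟩

theorem pushSec_add (hφ : IsLocalHomeomorph φ)
    (hfib : ∀ y y', φ y = φ y' → E.proj y = E.proj y') (u v : E.Fn 𝕜) :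
    pushSec hφ (u + v).sec = pushSec hφ u.sec + pushSec hφ v.sec := by
  funext z
  rw [Pi.add_apply, pushSec, pushSec, pushSec,
    ← finsum_add_distrib (push_finite hφ hfib u z) (push_finite hφ hfib v z)]
  refine finsum_congr fun y => ?_
  rw [map_add, Pi.add_apply, pushGerm_add]

theorem pushSec_zero (hφ : IsLocalHomeomorph φ) :
    pushSec hφ (0 : ∀ y : E.Total, Germ (𝓝 y) 𝕜) = 0 := by
  funext z
  exact (finsum_congr fun y => pushGerm_zero hφ y.2).trans finsum_zero

theorem pushSec_el_mem (hφ : IsLocalHomeomorph φ) {U : Set E.Total} (hinj : Set.InjOn φ U)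
    (f : Cc n M 𝕜) {y : E.Total} (hy : y ∈ U) {z : Y} (hz : φ y = z) :
    pushSec hφ (el E U f) z =
      pushGerm hφ hz ((f.1 ∘ E.proj : E.Total → 𝕜) : Germ (𝓝 y) 𝕜) := by
  rw [pushSec, finsum_eq_single _ (⟨y, hz⟩ : {y : E.Total // φ y = z}), el_mem f hy]
  rintro ⟨y', hy'⟩ hne
  have : y' ∉ U := fun hc => hne (Subtype.ext (hinj hc hy (hy'.trans hz.symm)))
  simp only [el_not_mem f this]
  exact pushGerm_zero hφ hy'

theorem pushSec_el_not_mem (hφ : IsLocalHomeomorph φ) {U : Set E.Total}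
    (f : Cc n M 𝕜) {z : Y} (hz : ∀ y ∈ U, φ y ≠ z) :
    pushSec hφ (el E U f) z = 0 := by
  rw [pushSec, finsum_eq_zero_of_forall_eq_zero]
  rintro ⟨y', hy'⟩
  have : y' ∉ U := fun hc => hz _ hc hy'
  simp only [el_not_mem f this]
  exact pushGerm_zero hφ hy'

end Push

theorem Cc.germ_eq_zero {f : Cc n M 𝕜} {x : M} (hx : x ∉ tsupport f.1) :
    (f.1 : Germ (𝓝 x) 𝕜) = 0 := Quotient.sound (Cc.eventually_zero f hx)

theorem IsEl.pushSec_proj {E : Sh n M} {U : Set E.Total} {f : Cc n M 𝕜} (h : IsEl E U f) :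
    pushSec E.isLocalHomeomorph (el E U f) = fun x => (f.1 : Germ (𝓝 x) 𝕜) := by
  funext x
  by_cases hx : ∃ y ∈ U, E.proj y = x
  · obtain ⟨y, hy, hyx⟩ := hx
    rw [pushSec_el_mem _ h.injOn f hy hyx, pushGerm_comp]
  · push Not at hx
    rw [pushSec_el_not_mem _ f hx, Cc.germ_eq_zero]
    intro hc
    obtain ⟨y, hy, rfl⟩ := h.supp hc
    exact hx y hy rfl

theorem IsEl.image {E F : Sh n M} (φ : Sh.Hom E F) {U : Set E.Total} {f : Cc n M 𝕜}
    (h : IsEl E U f) : IsEl F (φ.toFun '' U) f := by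
  refine ⟨φ.isLocalHomeomorph.isOpenMap U h.isOpen, ?_, fun x hx => ?_⟩
  · rintro _ ⟨y, hy, rfl⟩ _ ⟨z, hz, rfl⟩ hyz
    rw [φ.proj_toFun, φ.proj_toFun] at hyz
    rw [h.injOn hy hz hyz]
  · obtain ⟨y, hy, rfl⟩ := h.supp hx
    exact ⟨_, ⟨y, hy, rfl⟩, φ.proj_toFun y⟩

theorem Sh.Hom.fib {E F : Sh n M} (φ : Sh.Hom E F) (y y' : E.Total)
    (h : φ.toFun y = φ.toFun y') : E.proj y = E.proj y' := by
  rw [← φ.proj_toFun, h, φ.proj_toFun]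

theorem IsEl.pushSec_hom {E F : Sh n M} (φ : Sh.Hom E F) {U : Set E.Total} {f : Cc n M 𝕜}
    (h : IsEl E U f) :
    pushSec φ.isLocalHomeomorph (el E U f) = el F (φ.toFun '' U) f := by
  funext z
  by_cases hz : ∃ y ∈ U, φ.toFun y = z
  · obtain ⟨y, hy, rfl⟩ := hz
    rw [pushSec_el_mem _ (fun a ha b hb hab => h.injOn ha hb (φ.fib a b hab)) f hy rfl,
      el_mem f (Set.mem_image_of_mem _ hy), ← pushGerm_comp φ.isLocalHomeomorph rfl]
    congr 2
    funext w
    simp [φ.proj_toFun]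
  · push Not at hz
    rw [pushSec_el_not_mem _ f hz, el_not_mem]
    rintro ⟨y, hy, rfl⟩
    exact hz y hy rfl

theorem pushSec_mem {E F : Sh n M} (φ : Sh.Hom E F) (u : E.Fn 𝕜) :
    pushSec φ.isLocalHomeomorph u.sec ∈ CcSec n F.Total 𝕜 := by
  induction u using Sh.Fn.induction with
  | h0 => rw [map_zero, pushSec_zero]; exact zero_mem _
  | hel U f h => rw [elF_sec, h.pushSec_hom]; exact (h.image φ).el_mem_CcSec
  | hadd u v hu hv => rw [pushSec_add _ φ.fib]; exact add_mem hu hv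

/-- The pushforward as an additive map. -/
def Sh.Hom.pushHom {E F : Sh n M} (φ : Sh.Hom E F) : E.Fn 𝕜 →+ F.Fn 𝕜 :=
  AddMonoidHom.mk' (fun u => ⟨pushSec φ.isLocalHomeomorph u.sec, pushSec_mem φ u⟩)
    (fun u v => Sh.Fn.ext (pushSec_add _ φ.fib u v))

theorem Sh.Hom.pushHom_elF {E F : Sh n M} (φ : Sh.Hom E F) {U : Set E.Total} {f : Cc n M 𝕜}
    (h : IsEl E U f) : φ.pushHom (elF h) = elF (h.image φ) := Sh.Fn.ext (h.pushSec_hom φ)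

variable (𝕜) in
/-- The pushforward `φ_+ : C_c^∞(E) → C_c^∞(F)` of a morphism `φ : E → F` of sheaves. -/
def Sh.Hom.push {E F : Sh n M} (φ : Sh.Hom E F) : NULin (Cc n M 𝕜) (E.Fn 𝕜) (F.Fn 𝕜) where
  toAddMonoidHom := φ.pushHom
  map_smul' p u := by
    change φ.pushHom (p • u) = p • φ.pushHom u
    induction u using Sh.Fn.induction with
    | h0 => simp [nu_smul_zero]
    | hel U f h => rw [smul_elF, φ.pushHom_elF, φ.pushHom_elF, smul_elF]
    | hadd u v hu hv => simp [nu_smul_add, hu, hv]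

theorem Sh.Hom.push_elF {E F : Sh n M} (φ : Sh.Hom E F) {U : Set E.Total} {f : Cc n M 𝕜}
    (h : IsEl E U f) : φ.push 𝕜 (elF h) = elF (h.image φ) := φ.pushHom_elF h

theorem value_pushSec_mem {E : Sh n M} (u : E.Fn 𝕜) :
    (fun x => (pushSec E.isLocalHomeomorph u.sec x).value) ∈ Cc n M 𝕜 := by
  induction u using Sh.Fn.induction with
  | h0 => rw [map_zero, pushSec_zero]; exact zero_mem _
  | hel U f h => rw [elF_sec, h.pushSec_proj]; exact f.2
  | hadd u v hu hv =>
    rw [pushSec_add _ fun _ _ h => h]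
    convert add_mem hu hv using 1
    funext x
    exact map_add Germ.valueRingHom _ _

/-- The counit as an additive map. -/
def Sh.counitHom (E : Sh n M) : E.Fn 𝕜 →+ Cc n M 𝕜 :=
  AddMonoidHom.mk'
    (fun u => ⟨fun x => (pushSec E.isLocalHomeomorph u.sec x).value, value_pushSec_mem u⟩)
    (fun u v => Subtype.ext (by
      funext x
      change (pushSec E.isLocalHomeomorph (u + v).sec x).value = _
      rw [pushSec_add _ fun _ _ h => h]
      exact map_add Germ.valueRingHom _ _))

theorem Sh.counitHom_elF (E : Sh n M) {U : Set E.Total} {f : Cc n M 𝕜}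
    (h : IsEl E U f) : E.counitHom (elF h) = f := by
  refine Subtype.ext ?_
  change (fun x => (pushSec E.isLocalHomeomorph (el E U f) x).value) = f.1
  rw [h.pushSec_proj]
  rfl

variable (𝕜) in
/-- The counit `ε = π_+ : C_c^∞(E) → C_c^∞(M)`: the function whose value at `x` is the value at `x`
of the germ `π_+(u)_x`. -/
def Sh.counit (E : Sh n M) : NULin (Cc n M 𝕜) (E.Fn 𝕜) (Cc n M 𝕜) where
  toAddMonoidHom := E.counitHom
  map_smul' p u := by
    change E.counitHom (p • u) = p • E.counitHom u
    induction u using Sh.Fn.induction with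
    | h0 => simp [nu_smul_zero]
    | hel U f h => rw [smul_elF, E.counitHom_elF, E.counitHom_elF]; rfl
    | hadd u v hu hv => rw [nu_smul_add, map_add, hu, hv, map_add, nu_smul_add]

theorem Sh.counit_elF (E : Sh n M) {U : Set E.Total} {f : Cc n M 𝕜}
    (h : IsEl E U f) : E.counit 𝕜 (elF h) = f := E.counitHom_elF h

end SheafFunctions


noncomputable section Stalks

variable {n : ℕ} {M : Type u} [TopologicalSpace M] [ChartedSpace (EuclideanSpace ℝ (Fin n)) M]
  [IsManifold (𝓡 n) ∞ M] [T2Space M] {𝕜 : Type} [RCLike 𝕜]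
  {C : Type*} [AddCommGroup C] [NUModule (Cc n M 𝕜) C]
  {D : Type*} [AddCommGroup D] [NUModule (Cc n M 𝕜) D]

/-- The submodule `N_x(C)` of the elements annihilated by some function with germ `1` at `x`. -/
def stalkKer (x : M) (C : Type*) [AddCommGroup C] [NUModule (Cc n M 𝕜) C] : AddSubgroup C where
  carrier := {c | ∃ f : Cc n M 𝕜, (∀ᶠ y in 𝓝 x, f.1 y = 1) ∧ f • c = 0}
  zero_mem' := by
    obtain ⟨f, -, hf⟩ := exists_bump (n := n) 𝕜 x Filter.univ_mem
    exact ⟨f, hf, nu_smul_zero f⟩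
  add_mem' := by
    rintro c d ⟨f, hf, hc⟩ ⟨g, hg, hd⟩
    refine ⟨f * g, ?_, ?_⟩
    · filter_upwards [hf, hg] with y h1 h2
      simp [h1, h2]
    · rw [nu_smul_add, nu_mul_smul, nu_mul_smul, hd, nu_smul_comm, hc, nu_smul_zero,
        nu_smul_zero, add_zero]
  neg_mem' := by
    rintro c ⟨f, hf, hc⟩
    exact ⟨f, hf, by rw [nu_smul_neg, hc, neg_zero]⟩

theorem mem_stalkKer {x : M} {c : C} : c ∈ stalkKer (𝕜 := 𝕜) (n := n) x C ↔
    ∃ f : Cc n M 𝕜, (∀ᶠ y in 𝓝 x, f.1 y = 1) ∧ f • c = 0 := Iff.rfl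

variable (n 𝕜) in
/-- The local module `C_x = C / N_x(C)`. -/
def Stalk (x : M) (C : Type*) [AddCommGroup C] [NUModule (Cc n M 𝕜) C] : Type _ :=
  C ⧸ stalkKer (𝕜 := 𝕜) (n := n) x C

instance (x : M) : AddCommGroup (Stalk n 𝕜 x C) :=
  inferInstanceAs (AddCommGroup (C ⧸ stalkKer (𝕜 := 𝕜) (n := n) x C))

variable (n 𝕜) in
/-- The projection `C → C_x`, `c ↦ c_x`. -/
def stalkHom (x : M) : C →+ Stalk n 𝕜 x C := QuotientAddGroup.mk' (stalkKer x C)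

theorem stalkHom_surjective (x : M) : Function.Surjective (stalkHom n 𝕜 x (C := C)) :=
  QuotientAddGroup.mk'_surjective _

theorem stalkHom_eq_zero {x : M} {c : C} : stalkHom n 𝕜 x c = 0 ↔
    ∃ f : Cc n M 𝕜, (∀ᶠ y in 𝓝 x, f.1 y = 1) ∧ f • c = 0 :=
  (QuotientAddGroup.eq_zero_iff _).trans mem_stalkKer

theorem stalkHom_eq {x : M} {c d : C} : stalkHom n 𝕜 x c = stalkHom n 𝕜 x d ↔
    ∃ f : Cc n M 𝕜, (∀ᶠ y in 𝓝 x, f.1 y = 1) ∧ f • c = f • d := by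
  rw [← sub_eq_zero, ← map_sub, stalkHom_eq_zero]
  simp only [nu_smul_sub, sub_eq_zero]

/-- The additive map out of `C_x` induced by an additive map that vanishes on `N_x(C)`. -/
def stalkLift {B : Type*} [AddCommGroup B] {x : M} (b : C →+ B)
    (hb : ∀ (f : Cc n M 𝕜) (c : C), (∀ᶠ y in 𝓝 x, f.1 y = 1) → f • c = 0 → b c = 0) :
    Stalk n 𝕜 x C →+ B :=
  QuotientAddGroup.lift (stalkKer x C) b (fun c ⟨f, hf, hc⟩ => hb f c hf hc)

@[simp] theorem stalkLift_stalkHom {B : Type*} [AddCommGroup B] {x : M} (b : C →+ B)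
    (hb : ∀ (f : Cc n M 𝕜) (c : C), (∀ᶠ y in 𝓝 x, f.1 y = 1) → f • c = 0 → b c = 0) (c : C) :
    stalkLift b hb (stalkHom n 𝕜 x c) = b c := rfl

/-- Multiplication by `r` on `C_x`. -/
def stalkSmul (x : M) (r : Cc n M 𝕜) : Stalk n 𝕜 x C →+ Stalk n 𝕜 x C :=
  stalkLift ((stalkHom n 𝕜 x).comp (smulHom r)) (fun f c hf hc => by
    refine stalkHom_eq_zero.2 ⟨f, hf, ?_⟩
    rw [smulHom_apply, nu_smul_comm, hc, nu_smul_zero])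

/-- The `C_c^∞(M)`-module structure of `C_x`. -/
instance (x : M) : NUModule (Cc n M 𝕜) (Stalk n 𝕜 x C) where
  smul r t := stalkSmul x r t
  smul_add' r s t := map_add _ _ _
  add_smul' r s t := by
    obtain ⟨c, rfl⟩ := stalkHom_surjective x t
    exact (congrArg (stalkHom n 𝕜 x) (nu_add_smul r s c)).trans (map_add _ _ _)
  mul_smul' r s t := by
    obtain ⟨c, rfl⟩ := stalkHom_surjective x t
    exact congrArg (stalkHom n 𝕜 x) (nu_mul_smul r s c)

theorem smul_stalkHom (x : M) (r : Cc n M 𝕜) (c : C) :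
    r • stalkHom n 𝕜 x c = stalkHom n 𝕜 x (r • c) := rfl

variable (n 𝕜) in
/-- The projection `C → C_x` as a linear map. -/
def stalkMk (x : M) (C : Type*) [AddCommGroup C] [NUModule (Cc n M 𝕜) C] :
    NULin (Cc n M 𝕜) C (Stalk n 𝕜 x C) where
  toAddMonoidHom := stalkHom n 𝕜 x
  map_smul' _ _ := rfl

@[simp] theorem stalkMk_apply (x : M) (c : C) : stalkMk n 𝕜 x C c = stalkHom n 𝕜 x c := rfl

theorem stalk_smul_congr {x : M} {f g : Cc n M 𝕜} (h : ∀ᶠ y in 𝓝 x, f.1 y = g.1 y)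
    (t : Stalk n 𝕜 x C) : f • t = g • t := by
  obtain ⟨c, rfl⟩ := stalkHom_surjective x t
  rw [smul_stalkHom, smul_stalkHom, stalkHom_eq]
  obtain ⟨k, hk, hk1⟩ := exists_bump (n := n) 𝕜 x h
  refine ⟨k, hk1, ?_⟩
  rw [← nu_mul_smul, ← nu_mul_smul]
  congr 1
  ext y
  by_cases hy : y ∈ tsupport k.1
  · have : f.1 y = g.1 y := hk hy
    simp [this]
  · simp [image_eq_zero_of_notMem_tsupport hy]

theorem stalk_smul_one {x : M} {f : Cc n M 𝕜} (h : ∀ᶠ y in 𝓝 x, f.1 y = 1)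
    (t : Stalk n 𝕜 x C) : f • t = t := by
  obtain ⟨c, rfl⟩ := stalkHom_surjective x t
  rw [smul_stalkHom, stalkHom_eq]
  obtain ⟨k, hk, hk1⟩ := exists_bump (n := n) 𝕜 x h
  refine ⟨k, hk1, ?_⟩
  rw [← nu_mul_smul]
  congr 1
  ext y
  by_cases hy : y ∈ tsupport k.1
  · have : f.1 y = 1 := hk hy
    simp [this]
  · simp [image_eq_zero_of_notMem_tsupport hy]

/-- An element with a local identity vanishes if all its germs do. -/
theorem eq_zero_of_stalk {c : C} (r : Cc n M 𝕜) (hr : r • c = c)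
    (h : ∀ x : M, stalkHom n 𝕜 x c = 0) : c = 0 := by
  have key : ∃ f : Cc n M 𝕜, (∀ y ∈ tsupport r.1, f.1 y = 1) ∧ f • c = 0 := by
    refine (Cc.compact r).isCompact.induction_on
      (p := fun K => ∃ f : Cc n M 𝕜, (∀ y ∈ K, f.1 y = 1) ∧ f • c = 0) ?_ ?_ ?_ ?_
    · exact ⟨0, by simp, nu_zero_smul c⟩
    · rintro s t hst ⟨f, h1, h2⟩
      exact ⟨f, fun y hy => h1 y (hst hy), h2⟩
    · rintro s t ⟨f, h1, h2⟩ ⟨g, h3, h4⟩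
      refine ⟨f + g - f * g, ?_, ?_⟩
      · rintro y (hy | hy)
        · simp [h1 y hy]
        · simp [h3 y hy]
      · rw [nu_sub_smul, nu_add_smul, nu_mul_smul, h2, h4, nu_smul_zero]
        simp
    · intro x _
      obtain ⟨f, hf, hfc⟩ := stalkHom_eq_zero.1 (h x)
      exact ⟨_, mem_nhdsWithin_of_mem_nhds hf, f, fun y hy => hy, hfc⟩
  obtain ⟨f, hf, hfc⟩ := key
  have : r * f = r := by
    ext y
    by_cases hy : y ∈ tsupport r.1
    · simp [hf y hy]
    · simp [image_eq_zero_of_notMem_tsupport hy]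
  rw [← hr, ← this, nu_mul_smul, hfc, nu_smul_zero]

theorem stalk_tmul_congr {x : M} {c c' : C} {d d' : D}
    (hc : stalkHom n 𝕜 x c = stalkHom n 𝕜 x c') (hd : stalkHom n 𝕜 x d = stalkHom n 𝕜 x d') :
    stalkHom n 𝕜 x (BTensor.tmul (Cc n M 𝕜) c d) =
      stalkHom n 𝕜 x (BTensor.tmul (Cc n M 𝕜) c' d') := by
  obtain ⟨f, hf, hfc⟩ := stalkHom_eq.1 hc
  obtain ⟨g, hg, hgd⟩ := stalkHom_eq.1 hd
  refine stalkHom_eq.2 ⟨f * g, ?_, ?_⟩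
  · filter_upwards [hf, hg] with y h1 h2
    simp [h1, h2]
  · simp only [nu_mul_smul, BTensor.smul_def_tmul]
    rw [nu_smul_comm, hfc, BTensor.smul_tmul, hgd, ← BTensor.smul_tmul, nu_smul_comm]

end Stalks


noncomputable section Comultiplication

variable {n : ℕ} {M : Type u} [TopologicalSpace M] [ChartedSpace (EuclideanSpace ℝ (Fin n)) M]
  [IsManifold (𝓡 n) ∞ M] {𝕜 : Type} [RCLike 𝕜]

/-- The first projection `E ×_M F → E`. -/
def Sh.fst (E F : Sh n M) : Sh.Hom (E.prod F) E :=
  Sh.homOfContinuous (E := E.prod F) (fun p : Sh.FibreProd E F => p.1.1)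
    (continuous_fst.comp continuous_subtype_val) (fun _ => rfl)

/-- The second projection `E ×_M F → F`. -/
def Sh.snd (E F : Sh n M) : Sh.Hom (E.prod F) F :=
  Sh.homOfContinuous (E := E.prod F) (fun p : Sh.FibreProd E F => p.1.2)
    (continuous_snd.comp continuous_subtype_val) (fun p => p.2.symm)

/-- The pullback `φ^*_y` of germs along a continuous map. -/
def pullGerm {X Y : Type*} [TopologicalSpace X] [TopologicalSpace Y] {φ : X → Y}
    (hφ : Continuous φ) (y : X) (g : Germ (𝓝 (φ y)) 𝕜) : Germ (𝓝 y) 𝕜 :=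
  g.compTendsto φ hφ.continuousAt

theorem pullGerm_add {X Y : Type*} [TopologicalSpace X] [TopologicalSpace Y] {φ : X → Y}
    (hφ : Continuous φ) (y : X) (g g' : Germ (𝓝 (φ y)) 𝕜) :
    pullGerm hφ y (g + g') = pullGerm hφ y g + pullGerm hφ y g' := by
  induction g using Germ.inductionOn with | _ g =>
  induction g' using Germ.inductionOn with | _ g' =>
  rfl

/-- The section of germs `(pr₁^* u) (pr₂^* v)` on `E ×_M F`. -/
def omegaSec {E F : Sh n M} (u : ∀ y : E.Total, Germ (𝓝 y) 𝕜) (v : ∀ z : F.Total, Germ (𝓝 z) 𝕜) :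
    ∀ p : (E.prod F).Total, Germ (𝓝 p) 𝕜 :=
  fun p => pullGerm (Sh.fst E F).smooth.continuous p (u ((Sh.fst E F).toFun p)) *
    pullGerm (Sh.snd E F).smooth.continuous p (v ((Sh.snd E F).toFun p))

theorem omegaSec_add_left {E F : Sh n M} (u u' : ∀ y : E.Total, Germ (𝓝 y) 𝕜)
    (v : ∀ z : F.Total, Germ (𝓝 z) 𝕜) :
    omegaSec (u + u') v = omegaSec u v + omegaSec u' v := by
  funext p
  simp only [omegaSec, Pi.add_apply, pullGerm_add, add_mul]

theorem omegaSec_add_right {E F : Sh n M} (u : ∀ y : E.Total, Germ (𝓝 y) 𝕜)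
    (v v' : ∀ z : F.Total, Germ (𝓝 z) 𝕜) :
    omegaSec u (v + v') = omegaSec u v + omegaSec u v' := by
  funext p
  simp only [omegaSec, Pi.add_apply, pullGerm_add, mul_add]

/-- The elementary subset `U ×_M V`. -/
def prodSet (E F : Sh n M) (U : Set E.Total) (V : Set F.Total) : Set (E.prod F).Total :=
  {p | (Sh.fst E F).toFun p ∈ U ∧ (Sh.snd E F).toFun p ∈ V}

theorem proj_eq_fst {E F : Sh n M} (p : (E.prod F).Total) :
    (E.prod F).proj p = E.proj ((Sh.fst E F).toFun p) := ((Sh.fst E F).proj_toFun p).symm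

theorem proj_eq_snd {E F : Sh n M} (p : (E.prod F).Total) :
    (E.prod F).proj p = F.proj ((Sh.snd E F).toFun p) := ((Sh.snd E F).proj_toFun p).symm

theorem prod_ext {E F : Sh n M} {p q : (E.prod F).Total}
    (h1 : (Sh.fst E F).toFun p = (Sh.fst E F).toFun q)
    (h2 : (Sh.snd E F).toFun p = (Sh.snd E F).toFun q) : p = q :=
  Subtype.ext (Prod.ext h1 h2)

theorem exists_prod {E F : Sh n M} {y : E.Total} {z : F.Total} (h : E.proj y = F.proj z) :
    ∃ p : (E.prod F).Total, (Sh.fst E F).toFun p = y ∧ (Sh.snd E F).toFun p = z :=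
  ⟨(⟨(y, z), h⟩ : Sh.FibreProd E F), rfl, rfl⟩

theorem omegaSec_el {E F : Sh n M} (U : Set E.Total) (V : Set F.Total) (f g : Cc n M 𝕜) :
    omegaSec (el E U f) (el F V g) = el (E.prod F) (prodSet E F U V) (f * g) := by
  funext p
  by_cases h1 : (Sh.fst E F).toFun p ∈ U
  · by_cases h2 : (Sh.snd E F).toFun p ∈ V
    · rw [omegaSec, el_mem _ h1, el_mem _ h2, el_mem _ (show p ∈ prodSet E F U V from ⟨h1, h2⟩)]
      refine Quotient.sound (Eventually.of_forall fun q => ?_)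
      change f.1 (E.proj ((Sh.fst E F).toFun q)) * g.1 (F.proj ((Sh.snd E F).toFun q)) =
        f.1 ((E.prod F).proj q) * g.1 ((E.prod F).proj q)
      rw [← proj_eq_fst, ← proj_eq_snd]
    · rw [omegaSec, el_not_mem _ h2, el_not_mem _ (show p ∉ prodSet E F U V from fun h => h2 h.2)]
      exact mul_zero _
  · rw [omegaSec, el_not_mem _ h1, el_not_mem _ (show p ∉ prodSet E F U V from fun h => h1 h.1)]
    exact zero_mul _

theorem IsEl.prod [T2Space M] {E F : Sh n M} {U : Set E.Total} {V : Set F.Total} {f g : Cc n M 𝕜}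
    (hf : IsEl E U f) (hg : IsEl F V g) : IsEl (E.prod F) (prodSet E F U V) (f * g) := by
  refine ⟨(hf.isOpen.preimage (Sh.fst E F).smooth.continuous).inter
    (hg.isOpen.preimage (Sh.snd E F).smooth.continuous), ?_, ?_⟩
  · rintro p ⟨hp1, hp2⟩ q ⟨hq1, hq2⟩ hpq
    refine prod_ext (hf.injOn hp1 hq1 ?_) (hg.injOn hp2 hq2 ?_)
    · rw [← proj_eq_fst, ← proj_eq_fst, hpq]
    · rw [← proj_eq_snd, ← proj_eq_snd, hpq]
  · intro x hx
    have h1 : x ∈ tsupport f.1 := by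
      refine closure_mono (fun y hy => ?_) hx
      simp only [Function.mem_support, Cc.mul_apply] at hy
      exact left_ne_zero_of_mul hy
    have h2 : x ∈ tsupport g.1 := by
      refine closure_mono (fun y hy => ?_) hx
      simp only [Function.mem_support, Cc.mul_apply] at hy
      exact right_ne_zero_of_mul hy
    obtain ⟨y, hy, rfl⟩ := hf.supp h1
    obtain ⟨z, hz, hyz⟩ := hg.supp h2
    obtain ⟨p, rfl, rfl⟩ := exists_prod hyz.symm
    exact ⟨p, ⟨hy, hz⟩, proj_eq_fst p⟩

variable [T2Space M]

theorem omegaSec_mem {E F : Sh n M} (u : E.Fn 𝕜) (v : F.Fn 𝕜) :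
    omegaSec u.sec v.sec ∈ CcSec n (E.prod F).Total 𝕜 := by
  induction u using Sh.Fn.induction with
  | h0 =>
    have := omegaSec_add_left 0 0 v.sec (E := E)
    simp only [add_zero, left_eq_add] at this
    rw [map_zero, this]; exact zero_mem _
  | hel U f h =>
    induction v using Sh.Fn.induction with
    | h0 =>
      have := omegaSec_add_right (elF h).sec 0 0 (F := F)
      simp only [add_zero, left_eq_add] at this
      rw [map_zero, this]; exact zero_mem _
    | hel V g h' => rw [elF_sec, elF_sec, omegaSec_el]; exact (h.prod h').el_mem_CcSec
    | hadd u v hu hv => rw [map_add, omegaSec_add_right]; exact add_mem hu hv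
  | hadd u v hu hv => rw [map_add, omegaSec_add_left]; exact add_mem hu hv

/-- The biadditive map underlying `Ω`. -/
def omegaBi (E F : Sh n M) : E.Fn 𝕜 →+ F.Fn 𝕜 →+ (E.prod F).Fn 𝕜 :=
  AddMonoidHom.mk' (fun u => AddMonoidHom.mk' (fun v => ⟨omegaSec u.sec v.sec, omegaSec_mem u v⟩)
      (fun v v' => Sh.Fn.ext (omegaSec_add_right u.sec v.sec v'.sec)))
    (fun u u' => by
      ext v
      exact Sh.Fn.ext (omegaSec_add_left u.sec u'.sec v.sec))

theorem omegaBi_elF {E F : Sh n M} {U : Set E.Total} {V : Set F.Total} {f g : Cc n M 𝕜}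
    (hf : IsEl E U f) (hg : IsEl F V g) : omegaBi E F (elF hf) (elF hg) = elF (hf.prod hg) :=
  Sh.Fn.ext (omegaSec_el U V f g)

theorem omegaBi_smul_left {E F : Sh n M} (r : Cc n M 𝕜) (u : E.Fn 𝕜) (v : F.Fn 𝕜) :
    omegaBi E F (r • u) v = r • omegaBi E F u v := by
  induction u using Sh.Fn.induction with
  | h0 => simp [nu_smul_zero]
  | hel U f h =>
    induction v using Sh.Fn.induction with
    | h0 => simp [nu_smul_zero]
    | hel V g h' =>
      rw [smul_elF, omegaBi_elF, omegaBi_elF, smul_elF]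
      exact elF_congr _ _ rfl (mul_assoc _ _ _)
    | hadd u v hu hv => simp only [map_add, nu_smul_add, hu, hv]
  | hadd u u' hu hv => simp only [map_add, nu_smul_add, hu, hv, AddMonoidHom.add_apply]

theorem omegaBi_smul_right {E F : Sh n M} (r : Cc n M 𝕜) (u : E.Fn 𝕜) (v : F.Fn 𝕜) :
    omegaBi E F u (r • v) = r • omegaBi E F u v := by
  induction u using Sh.Fn.induction with
  | h0 => simp [nu_smul_zero]
  | hel U f h =>
    induction v using Sh.Fn.induction with
    | h0 => simp [nu_smul_zero]
    | hel V g h' =>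
      rw [smul_elF, omegaBi_elF, omegaBi_elF, smul_elF]
      exact elF_congr _ _ rfl (mul_left_comm _ _ _)
    | hadd u v hu hv => simp only [map_add, nu_smul_add, hu, hv]
  | hadd u u' hu hv => simp only [map_add, nu_smul_add, hu, hv, AddMonoidHom.add_apply]

/-- The additive map underlying `Ω`. -/
def omegaHom (E F : Sh n M) : BTensor (Cc n M 𝕜) (E.Fn 𝕜) (F.Fn 𝕜) →+ (E.prod F).Fn 𝕜 :=
  BTensor.lift (omegaBi E F) (fun r u v => by rw [omegaBi_smul_left, omegaBi_smul_right])

variable (𝕜) in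
/-- The natural map `Ω : C_c^∞(E) ⊗ C_c^∞(F) → C_c^∞(E ×_M F)`,
`Ω(u ⊗ v)_{(y,z)} = pr₁^*(u_y) pr₂^*(v_z)`. -/
def omega (E F : Sh n M) :
    NULin (Cc n M 𝕜) (BTensor (Cc n M 𝕜) (E.Fn 𝕜) (F.Fn 𝕜)) ((E.prod F).Fn 𝕜) where
  toAddMonoidHom := omegaHom E F
  map_smul' r t := by
    refine DFunLike.congr_fun (f := (omegaHom E F).comp (smulHom r))
      (g := (smulHom r).comp (omegaHom E F)) (BTensor.hom_ext ?_) t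
    intro u v
    exact omegaBi_smul_left r u v

theorem omega_tmul {E F : Sh n M} (u : E.Fn 𝕜) (v : F.Fn 𝕜) :
    omega 𝕜 E F (BTensor.tmul _ u v) = omegaBi E F u v := rfl

theorem omega_elF {E F : Sh n M} {U : Set E.Total} {V : Set F.Total} {f g : Cc n M 𝕜}
    (hf : IsEl E U f) (hg : IsEl F V g) :
    omega 𝕜 E F (BTensor.tmul _ (elF hf) (elF hg)) = elF (hf.prod hg) := omegaBi_elF hf hg

/-! ### Bijectivity of `Ω` -/

theorem IsEl.exists_unit {E : Sh n M} {U : Set E.Total} {f : Cc n M 𝕜} (h : IsEl E U f) :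
    ∃ η : Cc n M 𝕜, IsEl E U η ∧ η * f = f := by
  obtain ⟨η, h1, h2⟩ := exists_local_unit f (E.isLocalHomeomorph.isOpenMap U h.isOpen) h.supp
  exact ⟨η, ⟨h.isOpen, h.injOn, h1⟩, h2⟩

theorem Sh.Fn.isLocallyUnitary (E : Sh n M) : IsLocallyUnitary (Cc n M 𝕜) (E.Fn 𝕜) := by
  refine isLocallyUnitary_of_forall fun u => ?_
  induction u using Sh.Fn.induction with
  | h0 => exact ⟨0, nu_smul_zero _⟩
  | hel U f h =>
    obtain ⟨η, -, h2⟩ := h.exists_unit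
    exact ⟨η, by rw [smul_elF]; exact elF_congr _ _ rfl h2⟩
  | hadd u v hu hv =>
    obtain ⟨r, hr⟩ := hu
    obtain ⟨s, hs⟩ := hv
    refine ⟨r + s - r * s, ?_⟩
    rw [nu_smul_add, nu_sub_smul, nu_sub_smul, nu_add_smul, nu_add_smul, nu_mul_smul, nu_mul_smul,
      hs, nu_smul_comm, hr]
    abel

theorem omega_surjective (E F : Sh n M) : Function.Surjective (omega 𝕜 E F) := by
  intro w
  induction w using Sh.Fn.induction with
  | h0 => exact ⟨0, map_zero _⟩
  | hel W f h =>
    obtain ⟨η, hη, hηf⟩ := h.exists_unit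
    have e1 := h.image (Sh.fst E F)
    have e2 := hη.image (Sh.snd E F)
    refine ⟨BTensor.tmul _ (elF e1) (elF e2), ?_⟩
    rw [omega_elF]
    refine elF_congr _ _ ?_ (by rw [mul_comm, hηf])
    ext p
    refine ⟨?_, fun hp => ⟨⟨p, hp, rfl⟩, ⟨p, hp, rfl⟩⟩⟩
    rintro ⟨⟨q, hq, hq'⟩, ⟨q', hqq, hqq'⟩⟩
    have h1 : q = q' := by
      refine h.injOn hq hqq ?_
      rw [proj_eq_fst, hq', proj_eq_snd, hqq', ← proj_eq_fst, ← proj_eq_snd]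
    subst h1
    rwa [← prod_ext hq' hqq']
  | hadd u v hu hv =>
    obtain ⟨s, hs⟩ := hu
    obtain ⟨t, ht⟩ := hv
    exact ⟨s + t, by rw [map_add, hs, ht]⟩

section Theta

variable {D : Type*} [AddCommGroup D] [NUModule (Cc n M 𝕜) D]

open scoped Classical in
/-- The action of germs of smooth functions on `D_x` (zero on other germs). -/
def germAct (x : M) (g : Germ (𝓝 x) 𝕜) (t : Stalk n 𝕜 x D) : Stalk n 𝕜 x D :=
  if h : ∃ f : Cc n M 𝕜, (f.1 : Germ (𝓝 x) 𝕜) = g then h.choose • t else 0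

theorem germAct_coe (x : M) (f : Cc n M 𝕜) (t : Stalk n 𝕜 x D) :
    germAct x (f.1 : Germ (𝓝 x) 𝕜) t = f • t := by
  have h : ∃ f' : Cc n M 𝕜, (f'.1 : Germ (𝓝 x) 𝕜) = f.1 := ⟨f, rfl⟩
  rw [germAct, dif_pos h]
  exact stalk_smul_congr (Germ.coe_eq.1 h.choose_spec) t

theorem Sh.Fn.exists_germ {E : Sh n M} (u : E.Fn 𝕜) {y : E.Total} {x : M} (h : E.proj y = x) :
    ∃ f : Cc n M 𝕜, pushGerm E.isLocalHomeomorph h (u.sec y) = (f.1 : Germ (𝓝 x) 𝕜) := by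
  induction u using Sh.Fn.induction with
  | h0 => exact ⟨0, by rw [map_zero]; exact pushGerm_zero _ h⟩
  | hel U f hU =>
    by_cases hy : y ∈ U
    · exact ⟨f, by rw [elF_sec, el_mem f hy, pushGerm_comp]⟩
    · exact ⟨0, by rw [elF_sec, el_not_mem f hy]; exact pushGerm_zero _ h⟩
  | hadd u v hu hv =>
    obtain ⟨f, hf⟩ := hu
    obtain ⟨g, hg⟩ := hv
    exact ⟨f + g, by rw [map_add, Pi.add_apply, pushGerm_add, hf, hg]; rfl⟩

/-- The map `C_c^∞(E) → D_x` given by a family of elements of `D_x` indexed by the fibre of `E`. -/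
def theta {E : Sh n M} (x : M) (τ : {y : E.Total // E.proj y = x} → Stalk n 𝕜 x D) :
    E.Fn 𝕜 → Stalk n 𝕜 x D :=
  fun u => ∑ᶠ y : {y : E.Total // E.proj y = x},
    germAct x (pushGerm E.isLocalHomeomorph y.2 (u.sec y.1)) (τ y)

theorem germAct_zero (x : M) (t : Stalk n 𝕜 x D) : germAct x (0 : Germ (𝓝 x) 𝕜) t = 0 :=
  (germAct_coe x 0 t).trans (nu_zero_smul t)

theorem theta_finite {E : Sh n M} (x : M) (τ : {y : E.Total // E.proj y = x} → Stalk n 𝕜 x D)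
    (u : E.Fn 𝕜) : (Function.support fun y : {y : E.Total // E.proj y = x} =>
      germAct x (pushGerm E.isLocalHomeomorph y.2 (u.sec y.1)) (τ y)).Finite := by
  refine (push_finite E.isLocalHomeomorph (fun _ _ h => h) u x).subset fun y hy hy' => hy ?_
  simp only [hy', germAct_zero]

theorem theta_add {E : Sh n M} (x : M) (τ : {y : E.Total // E.proj y = x} → Stalk n 𝕜 x D)
    (u v : E.Fn 𝕜) : theta x τ (u + v) = theta x τ u + theta x τ v := by
  rw [theta, theta, theta, ← finsum_add_distrib (theta_finite x τ u) (theta_finite x τ v)]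
  refine finsum_congr fun y => ?_
  obtain ⟨f, hf⟩ := u.exists_germ y.2
  obtain ⟨g, hg⟩ := v.exists_germ y.2
  rw [map_add, Pi.add_apply, pushGerm_add, hf, hg, germAct_coe, germAct_coe]
  exact (germAct_coe x (f + g) _).trans (nu_add_smul f g _)

theorem theta_zero {E : Sh n M} (x : M) (τ : {y : E.Total // E.proj y = x} → Stalk n 𝕜 x D) :
    theta x τ 0 = 0 := by
  have := theta_add x τ 0 0
  simpa using this

theorem theta_elF_mem {E : Sh n M} (x : M) (τ : {y : E.Total // E.proj y = x} → Stalk n 𝕜 x D)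
    {U : Set E.Total} {f : Cc n M 𝕜} (h : IsEl E U f) (y : {y : E.Total // E.proj y = x})
    (hy : y.1 ∈ U) : theta x τ (elF h) = f • τ y := by
  rw [theta, finsum_eq_single _ y, elF_sec, el_mem f hy, pushGerm_comp, germAct_coe]
  intro z hz
  have : z.1 ∉ U := fun hc => hz (Subtype.ext (h.injOn hc hy (z.2.trans y.2.symm)))
  rw [elF_sec, el_not_mem f this]
  exact (congrArg (fun g => germAct x g (τ z)) (pushGerm_zero _ z.2)).trans (germAct_zero x _)

theorem theta_elF_not_mem {E : Sh n M} (x : M)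
    (τ : {y : E.Total // E.proj y = x} → Stalk n 𝕜 x D)
    {U : Set E.Total} {f : Cc n M 𝕜} (h : IsEl E U f) (hx : ∀ y ∈ U, E.proj y ≠ x) :
    theta x τ (elF h) = 0 := by
  rw [theta, finsum_eq_zero_of_forall_eq_zero]
  intro z
  have : z.1 ∉ U := fun hc => hx _ hc z.2
  rw [elF_sec, el_not_mem f this]
  exact (congrArg (fun g => germAct x g (τ z)) (pushGerm_zero _ z.2)).trans (germAct_zero x _)

end Theta

/-- Elementary functions agreeing near a point have the same germ. -/
theorem stalk_elF_congr {E : Sh n M} {U U' : Set E.Total} {f f' : Cc n M 𝕜} (h : IsEl E U f)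
    (h' : IsEl E U' f') {x : M} {y : E.Total} (hy : y ∈ U) (hy' : y ∈ U') (hyx : E.proj y = x)
    (hff : ∀ᶠ z in 𝓝 x, f.1 z = f'.1 z) :
    stalkHom n 𝕜 x (elF h) = stalkHom n 𝕜 x (elF h') := by
  have hW : E.proj '' (U ∩ U') ∈ 𝓝 x :=
    (E.isLocalHomeomorph.isOpenMap _ (h.isOpen.inter h'.isOpen)).mem_nhds ⟨y, ⟨hy, hy'⟩, hyx⟩
  obtain ⟨k, hk, hk1⟩ := exists_bump (n := n) 𝕜 x (Filter.inter_mem hW hff)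
  refine stalkHom_eq.2 ⟨k, hk1, ?_⟩
  have hkk : k * f = k * f' := by
    ext z
    by_cases hz : z ∈ tsupport k.1
    · have : f.1 z = f'.1 z := (hk hz).2
      simp [this]
    · simp [image_eq_zero_of_notMem_tsupport hz]
  have aux : ∀ (g : Cc n M 𝕜) (z : E.Total), E.proj z ∉ tsupport k.1 →
      (((k * g).1 ∘ E.proj : E.Total → 𝕜) : Germ (𝓝 z) 𝕜) = 0 := by
    intro g z hz
    refine Quotient.sound ?_
    have := E.isLocalHomeomorph.continuous.continuousAt.eventually (Cc.eventually_zero k hz)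
    filter_upwards [this] with w hw
    change k.1 (E.proj w) * g.1 (E.proj w) = 0
    rw [hw, zero_mul]
  rw [smul_elF, smul_elF]
  refine Sh.Fn.ext (funext fun z => ?_)
  rw [elF_sec, elF_sec]
  by_cases hz : E.proj z ∈ tsupport k.1
  · obtain ⟨w, ⟨hw, hw'⟩, hwz⟩ := (hk hz).1
    by_cases h1 : z ∈ U
    · have : w = z := h.injOn hw h1 hwz
      subst this
      rw [el_mem _ h1, el_mem _ hw', hkk]
    · by_cases h2 : z ∈ U'
      · have : w = z := h'.injOn hw' h2 hwz
        subst this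
        exact absurd hw h1
      · rw [el_not_mem _ h1, el_not_mem _ h2]
  · have aux' : ∀ (V : Set E.Total) (g : Cc n M 𝕜), el E V (k * g) z = 0 := by
      intro V g
      by_cases hzV : z ∈ V
      · rw [el_mem _ hzV, aux g z hz]
      · rw [el_not_mem _ hzV]
    rw [aux', aux']

/-- Elementary functions vanishing near a point have germ zero. -/
theorem stalk_elF_zero {E : Sh n M} {U : Set E.Total} {f : Cc n M 𝕜} (h : IsEl E U f)
    {x : M} (hx : ∀ y ∈ U, E.proj y ≠ x) : stalkHom n 𝕜 x (elF h) = 0 := by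
  have hx' : x ∉ tsupport f.1 := by
    intro hc
    obtain ⟨y, hy, hyx⟩ := h.supp hc
    exact hx y hy hyx
  obtain ⟨k, hk, hk1⟩ := exists_bump (n := n) 𝕜 x
    ((isClosed_tsupport f.1).isOpen_compl.mem_nhds hx')
  refine stalkHom_eq_zero.2 ⟨k, hk1, ?_⟩
  rw [smul_elF]
  refine Sh.Fn.ext (funext fun z => ?_)
  have : k * f = 0 := by
    ext z
    by_cases hz : z ∈ tsupport k.1
    · simp [image_eq_zero_of_notMem_tsupport (show z ∉ tsupport f.1 from hk hz)]
    · simp [image_eq_zero_of_notMem_tsupport hz]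
  rw [elF_sec, map_zero, Pi.zero_apply, this]
  by_cases hz : z ∈ U
  · rw [el_mem _ hz]; rfl
  · rw [el_not_mem _ hz]

theorem exists_elementary_bump (𝕜 : Type) [RCLike 𝕜] {E : Sh n M} (x : M)
    (y : {y : E.Total // E.proj y = x}) : ∃ (U : Set E.Total) (η : Cc n M 𝕜), IsEl E U η ∧
      y.1 ∈ U ∧ ∀ᶠ z in 𝓝 x, η.1 z = 1 := by
  obtain ⟨U, hU, hy, hinj⟩ := exists_elementary E y.1
  obtain ⟨η, h1, h2⟩ := exists_bump (n := n) 𝕜 x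
    ((E.isLocalHomeomorph.isOpenMap U hU).mem_nhds ⟨y.1, hy, y.2⟩)
  exact ⟨U, η, ⟨hU, hinj, h1⟩, hy, h2⟩

/-- The elementary function with germ one at a point of the total space. -/
def unitAt {E : Sh n M} (x : M) (y : {y : E.Total // E.proj y = x}) : E.Fn 𝕜 :=
  elF (exists_elementary_bump 𝕜 x y).choose_spec.choose_spec.1

theorem stalk_elF_unitAt {E : Sh n M} {U : Set E.Total} {f : Cc n M 𝕜} (h : IsEl E U f)
    (x : M) (y : {y : E.Total // E.proj y = x}) (hy : y.1 ∈ U) :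
    stalkHom n 𝕜 x (f • unitAt x y) = stalkHom n 𝕜 x (elF h) := by
  have hs := (exists_elementary_bump 𝕜 x y).choose_spec.choose_spec
  rw [unitAt, smul_elF]
  refine stalk_elF_congr _ _ hs.2.1 hy y.2 ?_
  filter_upwards [hs.2.2] with z hz
  rw [Cc.mul_apply, hz, mul_one]

theorem omega_injective (E F : Sh n M) : Function.Injective (omega 𝕜 E F) := by
  have key : ∀ (x : M) (t : BTensor (Cc n M 𝕜) (E.Fn 𝕜) (F.Fn 𝕜)),
      theta (E := E.prod F) x (fun p => stalkHom n 𝕜 x (BTensor.tmul (Cc n M 𝕜)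
        (unitAt x ⟨(Sh.fst E F).toFun p.1, (proj_eq_fst p.1).symm.trans p.2⟩)
        (unitAt x ⟨(Sh.snd E F).toFun p.1, (proj_eq_snd p.1).symm.trans p.2⟩)))
        (omega 𝕜 E F t) = stalkHom n 𝕜 x t := by
    intro x t
    induction t using BTensor.induction_on with
    | h0 => rw [map_zero, theta_zero, map_zero]
    | h2 s t hs ht => rw [map_add, theta_add, map_add, hs, ht]
    | h1 u v =>
      induction u using Sh.Fn.induction with
      | h0 => rw [BTensor.zero_tmul, map_zero, theta_zero, map_zero]
      | hadd u u' hu hu' => rw [BTensor.add_tmul, map_add, theta_add, map_add, hu, hu']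
      | hel U f h =>
        induction v using Sh.Fn.induction with
        | h0 => rw [BTensor.tmul_zero, map_zero, theta_zero, map_zero]
        | hadd u u' hu hu' => rw [BTensor.tmul_add, map_add, theta_add, map_add, hu, hu']
        | hel V g h' =>
          rw [omega_elF]
          by_cases hU : ∃ y ∈ U, E.proj y = x
          · obtain ⟨y, hy, hyx⟩ := hU
            by_cases hV : ∃ z ∈ V, F.proj z = x
            · obtain ⟨z, hz, hzx⟩ := hV
              obtain ⟨p, rfl, rfl⟩ := exists_prod (hyx.trans hzx.symm)
              rw [theta_elF_mem x _ (h.prod h') ⟨p, (proj_eq_fst p).trans hyx⟩ ⟨hy, hz⟩]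
              rw [smul_stalkHom, nu_mul_smul, BTensor.smul_def_tmul, BTensor.smul_tmul,
                BTensor.smul_def_tmul]
              exact stalk_tmul_congr (stalk_elF_unitAt h x ⟨_, hyx⟩ hy)
                (stalk_elF_unitAt h' x ⟨_, hzx⟩ hz)
            · push Not at hV
              rw [theta_elF_not_mem x _ (h.prod h') (fun p hp hpx =>
                hV _ hp.2 ((proj_eq_snd p).symm.trans hpx))]
              rw [stalk_tmul_congr rfl ((stalk_elF_zero h' hV).trans (map_zero _).symm),
                BTensor.tmul_zero, map_zero]
          · push Not at hU
            rw [theta_elF_not_mem x _ (h.prod h') (fun p hp hpx =>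
              hU _ hp.1 ((proj_eq_fst p).symm.trans hpx))]
            rw [stalk_tmul_congr ((stalk_elF_zero h hU).trans (map_zero _).symm) rfl,
              BTensor.zero_tmul, map_zero]
  have hlu : ∀ t : BTensor (Cc n M 𝕜) (E.Fn 𝕜) (F.Fn 𝕜), ∃ r : Cc n M 𝕜, r • t = t := by
    intro t
    induction t using BTensor.induction_on with
    | h0 => exact ⟨0, nu_smul_zero _⟩
    | h1 u v =>
      obtain ⟨r, hr⟩ := Sh.Fn.isLocallyUnitary E {u}
      exact ⟨r, by rw [BTensor.smul_def_tmul, hr u (Finset.mem_singleton_self u)]⟩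
    | h2 u v hu hv =>
      obtain ⟨r, hr⟩ := hu
      obtain ⟨s, hs⟩ := hv
      refine ⟨r + s - r * s, ?_⟩
      rw [nu_smul_add, nu_sub_smul, nu_sub_smul, nu_add_smul, nu_add_smul, nu_mul_smul,
        nu_mul_smul, hs, nu_smul_comm, hr]
      abel
  refine (injective_iff_map_eq_zero _).2 fun t ht => ?_
  obtain ⟨r, hr⟩ := hlu t
  refine eq_zero_of_stalk r hr fun x => ?_
  rw [← key x t, ht, theta_zero]

end Comultiplication


noncomputable section SheafCoalgebra

variable {n : ℕ} {M : Type u} [TopologicalSpace M] [ChartedSpace (EuclideanSpace ℝ (Fin n)) M]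
  [IsManifold (𝓡 n) ∞ M] [T2Space M] {𝕜 : Type} [RCLike 𝕜]

/-- The isomorphism of abelian groups underlying `Ω`. -/
def omegaEquiv (E F : Sh n M) :
    BTensor (Cc n M 𝕜) (E.Fn 𝕜) (F.Fn 𝕜) ≃+ (E.prod F).Fn 𝕜 :=
  AddEquiv.ofBijective (omega 𝕜 E F).toAddMonoidHom ⟨omega_injective E F, omega_surjective E F⟩

variable (𝕜) in
/-- The comultiplication `Δ = Ω⁻¹ ∘ diag_+` of `C_c^∞(E)`. -/
def Sh.comul (E : Sh n M) :
    NULin (Cc n M 𝕜) (E.Fn 𝕜) (BTensor (Cc n M 𝕜) (E.Fn 𝕜) (E.Fn 𝕜)) where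
  toAddMonoidHom := (omegaEquiv E E).symm.toAddMonoidHom.comp (E.diag.push 𝕜).toAddMonoidHom
  map_smul' r u := by
    change (omegaEquiv E E).symm (E.diag.push 𝕜 (r • u)) =
      r • (omegaEquiv E E).symm (E.diag.push 𝕜 u)
    rw [AddEquiv.symm_apply_eq]
    change _ = omega 𝕜 E E (r • (omegaEquiv E E).symm (E.diag.push 𝕜 u))
    rw [NULin.map_smul, NULin.map_smul]
    congr 1
    exact ((omegaEquiv E E).apply_symm_apply _).symm

theorem Sh.omega_comul (E : Sh n M) (u : E.Fn 𝕜) :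
    omega 𝕜 E E (E.comul 𝕜 u) = E.diag.push 𝕜 u :=
  (omegaEquiv E E).apply_symm_apply _

theorem Sh.comul_elF (E : Sh n M) {U : Set E.Total} {f η : Cc n M 𝕜} (h : IsEl E U f)
    (hη : IsEl E U η) (hf : η * f = f) :
    E.comul 𝕜 (elF h) = BTensor.tmul _ (elF h) (elF hη) := by
  apply omega_injective E E
  rw [E.omega_comul, E.diag.push_elF, omega_elF]
  refine elF_congr _ _ ?_ (by rw [mul_comm, hf])
  ext p
  refine ⟨?_, ?_⟩
  · rintro ⟨y, hy, rfl⟩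
    exact ⟨hy, hy⟩
  · rintro ⟨h1, h2⟩
    refine ⟨_, h1, prod_ext rfl (h.injOn h1 h2 ?_)⟩
    rw [← proj_eq_fst, ← proj_eq_snd]

variable (𝕜) in
/-- The sheaf coalgebra `C_c^∞(E)` over `C_c^∞(M)`. -/
def Sh.coalg (E : Sh n M) : CoAlg.{u} (Cc n M 𝕜) where
  carrier := E.Fn 𝕜
  locallyUnitary := Sh.Fn.isLocallyUnitary E
  comul := E.comul 𝕜
  counit := E.counit 𝕜
  counit_comul u := by
    induction u using Sh.Fn.induction with
    | h0 => simp only [map_zero]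
    | hel U f h =>
      obtain ⟨η, hη, hf⟩ := h.exists_unit
      rw [E.comul_elF h hη hf, BTensor.map_tmul, BTensor.leftUnitor_tmul, E.counit_elF,
        NULin.id_apply, smul_elF]
      exact elF_congr _ _ rfl (by rw [mul_comm, hf])
    | hadd u v hu hv => simp only [map_add, hu, hv]
  comul_counit u := by
    induction u using Sh.Fn.induction with
    | h0 => simp only [map_zero]
    | hel U f h =>
      obtain ⟨η, hη, hf⟩ := h.exists_unit
      rw [E.comul_elF h hη hf, BTensor.map_tmul, BTensor.rightUnitor_tmul, E.counit_elF,
        NULin.id_apply, smul_elF]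
      exact elF_congr _ _ rfl hf
    | hadd u v hu hv => simp only [map_add, hu, hv]

variable (𝕜) in
/-- The coalgebra homomorphism `φ_+ : C_c^∞(E) → C_c^∞(F)` of a morphism of sheaves. -/
def Sh.Hom.coalgHom {E F : Sh n M} (φ : Sh.Hom E F) : CoAlg.Hom (E.coalg 𝕜) (F.coalg 𝕜) where
  lin := φ.push 𝕜
  comul_lin u := by
    change F.comul 𝕜 (φ.push 𝕜 u) = BTensor.map (φ.push 𝕜) (φ.push 𝕜) (E.comul 𝕜 u)
    induction u using Sh.Fn.induction with
    | h0 => simp only [map_zero]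
    | hel U f h =>
      obtain ⟨η, hη, hf⟩ := h.exists_unit
      rw [E.comul_elF h hη hf, BTensor.map_tmul, φ.push_elF, φ.push_elF,
        F.comul_elF (h.image φ) (hη.image φ) hf]
    | hadd u v hu hv => simp only [map_add, hu, hv]
  counit_lin u := by
    change F.counit 𝕜 (φ.push 𝕜 u) = E.counit 𝕜 u
    induction u using Sh.Fn.induction with
    | h0 => simp only [map_zero]
    | hel U f h => rw [φ.push_elF, F.counit_elF, E.counit_elF]
    | hadd u v hu hv => simp only [map_add, hu, hv]

variable (n M 𝕜) in
/-- The functor `C_c^∞` from sheaves on `M` to coalgebras over `C_c^∞(M)`. -/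
def ccFunctor : Sh n M ⥤ CoAlg.{u} (Cc n M 𝕜) where
  obj E := E.coalg 𝕜
  map φ := Sh.Hom.coalgHom 𝕜 φ
  map_id E := by
    refine CoAlg.Hom.ext (NULin.ext fun u => ?_)
    change Sh.Hom.push 𝕜 (𝟙 E : E ⟶ E) u = u
    induction u using Sh.Fn.induction with
    | h0 => simp only [map_zero]
    | hel U f h =>
      rw [Sh.Hom.push_elF]
      exact elF_congr _ _ (Set.image_id U) rfl
    | hadd u v hu hv => simp only [map_add, hu, hv]
  map_comp {E F G} φ ψ := by
    refine CoAlg.Hom.ext (NULin.ext fun u => ?_)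
    change Sh.Hom.push 𝕜 (φ ≫ ψ : E ⟶ G) u = Sh.Hom.push 𝕜 ψ (Sh.Hom.push 𝕜 φ u)
    induction u using Sh.Fn.induction with
    | h0 => simp only [map_zero]
    | hel U f h =>
      rw [Sh.Hom.push_elF, Sh.Hom.push_elF, Sh.Hom.push_elF]
      exact elF_congr _ _ (Set.image_comp ψ.toFun φ.toFun U) rfl
    | hadd u v hu hv => simp only [map_add, hu, hv]

end SheafCoalgebra

noncomputable section Spectral

variable {n : ℕ} {M : Type u} [TopologicalSpace M] [ChartedSpace (EuclideanSpace ℝ (Fin n)) M]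
  [IsManifold (𝓡 n) ∞ M] [T2Space M] {𝕜 : Type} [RCLike 𝕜]

/-- The map `α_x : C_x → D_x` induced by `α : C → D`. -/
def stalkMap (x : M) {C D : Type*} [AddCommGroup C] [NUModule (Cc n M 𝕜) C] [AddCommGroup D]
    [NUModule (Cc n M 𝕜) D] (α : NULin (Cc n M 𝕜) C D) :
    NULin (Cc n M 𝕜) (Stalk n 𝕜 x C) (Stalk n 𝕜 x D) where
  toAddMonoidHom := stalkLift ((stalkHom n 𝕜 x).comp α.toAddMonoidHom) (fun f c hf hc => by
    refine stalkHom_eq_zero.2 ⟨f, hf, ?_⟩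
    rw [← α.map_smul, hc, map_zero])
  map_smul' r t := by
    obtain ⟨c, rfl⟩ := stalkHom_surjective x t
    exact congrArg (stalkHom n 𝕜 x) (α.map_smul r c)

theorem stalkMap_stalkHom (x : M) {C D : Type*} [AddCommGroup C] [NUModule (Cc n M 𝕜) C]
    [AddCommGroup D] [NUModule (Cc n M 𝕜) D] (α : NULin (Cc n M 𝕜) C D) (c : C) :
    stalkMap x α (stalkHom n 𝕜 x c) = stalkHom n 𝕜 x (α c) := rfl

/-- The map `D_x → (C ⊗ D)_x`, `d_x ↦ (c ⊗ d)_x`. -/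
def stalkTmulRight (x : M) {C : Type*} (D : Type*) [AddCommGroup C] [NUModule (Cc n M 𝕜) C]
    [AddCommGroup D] [NUModule (Cc n M 𝕜) D] (c : C) :
    Stalk n 𝕜 x D →+ Stalk n 𝕜 x (BTensor (Cc n M 𝕜) C D) :=
  stalkLift ((stalkHom n 𝕜 x).comp (BTensor.mkHom c)) (fun f d hf hd => by
    refine stalkHom_eq_zero.2 ⟨f, hf, ?_⟩
    rw [BTensor.mkHom_apply, BTensor.smul_def_tmul, BTensor.smul_tmul, hd, BTensor.tmul_zero])

/-- The map `C → Hom(D_x, (C ⊗ D)_x)`. -/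
def stalkTmulLeft (x : M) (C D : Type*) [AddCommGroup C] [NUModule (Cc n M 𝕜) C]
    [AddCommGroup D] [NUModule (Cc n M 𝕜) D] :
    C →+ Stalk n 𝕜 x D →+ Stalk n 𝕜 x (BTensor (Cc n M 𝕜) C D) :=
  AddMonoidHom.mk' (stalkTmulRight x D) (fun c c' => by
    refine DFunLike.ext _ _ fun d => ?_
    obtain ⟨d, rfl⟩ := stalkHom_surjective x d
    exact (congrArg (stalkHom n 𝕜 x) (BTensor.add_tmul c c' d)).trans (map_add _ _ _))

/-- The canonical map `C_x ⊗ D_x → (C ⊗ D)_x`. -/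
def stalkTensor (x : M) (C D : Type*) [AddCommGroup C] [NUModule (Cc n M 𝕜) C] [AddCommGroup D]
    [NUModule (Cc n M 𝕜) D] :
    BTensor (Cc n M 𝕜) (Stalk n 𝕜 x C) (Stalk n 𝕜 x D) →+
      Stalk n 𝕜 x (BTensor (Cc n M 𝕜) C D) :=
  BTensor.lift
    (stalkLift (stalkTmulLeft x C D) (fun f c hf hc => by
      refine DFunLike.ext _ _ fun d => ?_
      obtain ⟨d, rfl⟩ := stalkHom_surjective x d
      refine stalkHom_eq_zero.2 ⟨f, hf, ?_⟩
      rw [BTensor.mkHom_apply, BTensor.smul_def_tmul, hc, BTensor.zero_tmul]))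
    (fun r c d => by
      obtain ⟨c, rfl⟩ := stalkHom_surjective x c
      obtain ⟨d, rfl⟩ := stalkHom_surjective x d
      exact congrArg (stalkHom n 𝕜 x) (BTensor.smul_tmul r c d))

theorem stalkTensor_map (x : M) {C D : Type*} [AddCommGroup C] [NUModule (Cc n M 𝕜) C]
    [AddCommGroup D] [NUModule (Cc n M 𝕜) D] (t : BTensor (Cc n M 𝕜) C D) :
    stalkTensor x C D (BTensor.map (stalkMk n 𝕜 x C) (stalkMk n 𝕜 x D) t) =
      stalkHom n 𝕜 x t := by
  induction t using BTensor.induction_on with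
  | h0 => simp only [map_zero]
  | h1 c d => rfl
  | h2 s t hs ht => simp only [map_add, hs, ht]

theorem stalk_tensor_smul_one {x : M} {C D : Type*} [AddCommGroup C] [NUModule (Cc n M 𝕜) C]
    [AddCommGroup D] [NUModule (Cc n M 𝕜) D] {f : Cc n M 𝕜} (hf : ∀ᶠ y in 𝓝 x, f.1 y = 1)
    (t : BTensor (Cc n M 𝕜) (Stalk n 𝕜 x C) (Stalk n 𝕜 x D)) : f • t = t := by
  induction t using BTensor.induction_on with
  | h0 => exact nu_smul_zero f
  | h1 c d => rw [BTensor.smul_def_tmul, stalk_smul_one hf]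
  | h2 s t hs ht => rw [nu_smul_add, hs, ht]

/-! ### Local coalgebras and grouplike elements

The ring of germs of smooth functions at `x` is the quotient of `C_c^∞(M)` by `N_x(C_c^∞(M))`, and
`C_c^∞(M)` acts on `C_x` through it. Hence the tensor product `C_x ⊗ C_x` over this ring is the
tensor product over `C_c^∞(M)`. -/

variable (C : CoAlg.{u} (Cc n M 𝕜))

/-- The comultiplication `Δ_x : C_x → C_x ⊗ C_x` induced by `Δ`. -/
def localComul (x : M) : Stalk n 𝕜 x C.carrier →+
    BTensor (Cc n M 𝕜) (Stalk n 𝕜 x C.carrier) (Stalk n 𝕜 x C.carrier) :=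
  stalkLift ((BTensor.map (stalkMk n 𝕜 x C.carrier)
      (stalkMk n 𝕜 x C.carrier)).toAddMonoidHom.comp C.comul.toAddMonoidHom)
    (fun f c hf hc => by
      rw [AddMonoidHom.comp_apply, ← stalk_tensor_smul_one hf (BTensor.map _ _ _),
        ← NULin.map_smul, ← NULin.map_smul, hc, map_zero, map_zero])

theorem localComul_stalkHom (x : M) (c : C.carrier) : localComul C x (stalkHom n 𝕜 x c) =
    BTensor.map (stalkMk n 𝕜 x C.carrier) (stalkMk n 𝕜 x C.carrier) (C.comul c) := rfl

/-- The germ at `x` of a function. -/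
def germHom (x : M) : Cc n M 𝕜 →+ Germ (𝓝 x) 𝕜 :=
  AddMonoidHom.mk' (fun f => (f.1 : Germ (𝓝 x) 𝕜)) (fun _ _ => rfl)

/-- The counit `ε_x` of `C_x` induced by `ε`, with values in the germs of functions at `x`. -/
def localCounit (x : M) : Stalk n 𝕜 x C.carrier →+ Germ (𝓝 x) 𝕜 :=
  stalkLift ((germHom x).comp C.counit.toAddMonoidHom) (fun f c hf hc => by
    have h : f * C.counit c = 0 := by
      rw [← nu_self_smul, ← NULin.map_smul, hc, map_zero]
    refine Quotient.sound ?_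
    filter_upwards [hf] with y hy
    have := congrFun (congrArg Subtype.val h) y
    change f.1 y * (C.counit c).1 y = 0 at this
    rwa [hy, one_mul] at this)

theorem localCounit_stalkHom (x : M) (c : C.carrier) : localCounit C x (stalkHom n 𝕜 x c) =
    ((C.counit c).1 : Germ (𝓝 x) 𝕜) := rfl

/-- The set `G(C_x)` of grouplike elements of the local coalgebra `C_x`. -/
def grouplike (x : M) : Set (Stalk n 𝕜 x C.carrier) :=
  {ζ | localComul C x ζ = BTensor.tmul _ ζ ζ ∧ localCounit C x ζ = 1}

/-- The weakly grouplike elements of `C`: `Δ(c) = c ⊗ c'` for some `c'`. -/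
def IsWeaklyGrouplike {C : CoAlg.{u} (Cc n M 𝕜)} (c : C.carrier) : Prop :=
  ∃ c' : C.carrier, C.comul c = BTensor.tmul _ c c'

/-- `c` is normalized on `W`: the germ of `ε(c)` at each point of `W` is one. -/
def IsNormalizedOn {C : CoAlg.{u} (Cc n M 𝕜)} (c : C.carrier) (W : Set M) : Prop :=
  ∀ x ∈ W, ((C.counit c).1 : Germ (𝓝 x) 𝕜) = 1

/-- The total space of the spectral sheaf: the disjoint union of the sets `G(C_x)`. -/
def SpecTotal : Type u := Σ x : M, grouplike C x

/-- The projection of the spectral sheaf. -/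
def specProj (p : SpecTotal C) : M := p.1

/-- The set `c_W` of the germs `c_x`, `x ∈ W`. -/
def basicSet {C : CoAlg.{u} (Cc n M 𝕜)} (c : C.carrier) (W : Set M) : Set (SpecTotal C) :=
  {p | p.1 ∈ W ∧ (p.2 : Stalk n 𝕜 p.1 C.carrier) = stalkHom n 𝕜 p.1 c}

/-- The sets `c_W` with `W` open and `c` weakly grouplike and normalized on `W`. -/
def basicSets : Set (Set (SpecTotal C)) :=
  {S | ∃ (c : C.carrier) (W : Set M), IsOpen W ∧ IsWeaklyGrouplike c ∧ IsNormalizedOn c W ∧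
    S = basicSet c W}

/-- The topology of the spectral sheaf is generated by the sets `c_W`. -/
instance : TopologicalSpace (SpecTotal C) := TopologicalSpace.generateFrom (basicSets C)

variable {C}

/-- Germs of normalized weakly grouplike elements are grouplike. -/
theorem IsWeaklyGrouplike.stalk_mem {c : C.carrier} (h : IsWeaklyGrouplike c) {x : M}
    (hx : ((C.counit c).1 : Germ (𝓝 x) 𝕜) = 1) : stalkHom n 𝕜 x c ∈ grouplike C x := by
  obtain ⟨c', hc'⟩ := h
  have h1 : C.counit c • c' = c := by
    have := C.counit_comul c
    rwa [hc', BTensor.map_tmul, BTensor.leftUnitor_tmul] at this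
  have h2 : stalkHom n 𝕜 x c = stalkHom n 𝕜 x c' := by
    rw [← stalk_smul_one (Germ.coe_eq.1 hx) (stalkHom n 𝕜 x c'), smul_stalkHom, h1]
  refine ⟨?_, hx⟩
  rw [localComul_stalkHom, hc', BTensor.map_tmul, stalkMk_apply, stalkMk_apply, ← h2]

/-- The sets `c_W` cover the spectral sheaf. -/
theorem exists_basicSet (p : SpecTotal C) {W : Set M} (hW : W ∈ 𝓝 p.1) :
    ∃ (c : C.carrier) (V : Set M), IsOpen V ∧ V ⊆ W ∧ IsWeaklyGrouplike c ∧
      IsNormalizedOn c V ∧ p ∈ basicSet c V := by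
  obtain ⟨x, ζ, hζ, hζ'⟩ := p
  obtain ⟨c, rfl⟩ := stalkHom_surjective x ζ
  have h1 : stalkHom n 𝕜 x (C.comul c) = stalkHom n 𝕜 x (BTensor.tmul _ c c) := by
    rw [← stalkTensor_map, ← stalkTensor_map]
    exact congrArg _ hζ
  obtain ⟨f, hf, hfc⟩ := stalkHom_eq.1 h1
  have hfe : ∀ᶠ y in 𝓝 x, f.1 y * (C.counit c).1 y = 1 := by
    filter_upwards [hf, Germ.coe_eq.1 hζ'] with y h2 h3
    rw [h2, h3, one_mul]
  obtain ⟨V, hV, hVo, hxV⟩ := mem_nhds_iff.1 (Filter.inter_mem hfe hW)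
  refine ⟨f • c, V, hVo, fun y hy => (hV hy).2, ⟨c, ?_⟩, ?_, hxV, ?_⟩
  · rw [NULin.map_smul, hfc, BTensor.smul_def_tmul]
  · intro y hy
    refine Quotient.sound ?_
    filter_upwards [hVo.mem_nhds hy] with z hz
    rw [NULin.map_smul]
    exact (hV hz).1
  · change stalkHom n 𝕜 x c = stalkHom n 𝕜 x (f • c)
    rw [← smul_stalkHom, stalk_smul_one hf]

/-- Equality of germs at a point implies equality of germs nearby. -/
theorem eventually_stalk_eq {A : Type*} [AddCommGroup A] [NUModule (Cc n M 𝕜) A] {c d : A} {x : M}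
    (h : stalkHom n 𝕜 x c = stalkHom n 𝕜 x d) :
    ∀ᶠ y in 𝓝 x, stalkHom n 𝕜 y c = stalkHom n 𝕜 y d := by
  obtain ⟨f, hf, hfc⟩ := stalkHom_eq.1 h
  filter_upwards [hf.eventually_nhds] with y hy
  exact stalkHom_eq.2 ⟨f, hy, hfc⟩

variable (C)

theorem isTopologicalBasis_basicSets : TopologicalSpace.IsTopologicalBasis (basicSets C) where
  exists_subset_inter := by
    rintro _ ⟨c, W, hW, hc, hcW, rfl⟩ _ ⟨d, V, hV, hd, hdV, rfl⟩ p ⟨⟨hpW, hpc⟩, ⟨hpV, hpd⟩⟩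
    obtain ⟨T, hT, hTo, hpT⟩ := mem_nhds_iff.1 (eventually_stalk_eq (hpc.symm.trans hpd))
    refine ⟨_, ⟨c, T ∩ (W ∩ V), hTo.inter (hW.inter hV), hc, fun x hx => hcW x hx.2.1, rfl⟩,
      ⟨⟨hpT, hpW, hpV⟩, hpc⟩, ?_⟩
    rintro q ⟨⟨hqT, hqW, hqV⟩, hqc⟩
    exact ⟨⟨hqW, hqc⟩, ⟨hqV, hqc.trans (hT hqT)⟩⟩
  sUnion_eq := by
    refine Set.eq_univ_of_forall fun p => ?_
    obtain ⟨c, V, hV, -, hc, hcV, hp⟩ := exists_basicSet p Filter.univ_mem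
    exact ⟨_, ⟨c, V, hV, hc, hcV, rfl⟩, hp⟩
  eq_generateFrom := rfl

theorem specProj_isLocalHomeomorph : IsLocalHomeomorph (specProj C) := by
  refine isLocalHomeomorph_of_open ?_ ?_ ?_
  · refine continuous_def.2 fun W hW => ?_
    refine (isTopologicalBasis_basicSets C).isOpen_iff.2 fun p hp => ?_
    obtain ⟨c, V, hV, hVW, hc, hcV, hpV⟩ := exists_basicSet p (hW.mem_nhds hp)
    exact ⟨_, ⟨c, V, hV, hc, hcV, rfl⟩, hpV, fun q hq => hVW hq.1⟩
  · refine (isTopologicalBasis_basicSets C).isOpenMap_iff.2 ?_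
    rintro _ ⟨c, W, hW, hc, hcW, rfl⟩
    convert hW
    ext x
    refine ⟨?_, fun hx => ?_⟩
    · rintro ⟨p, hp, rfl⟩
      exact hp.1
    · exact ⟨⟨x, stalkHom n 𝕜 x c, hc.stalk_mem (hcW x hx)⟩, ⟨hx, rfl⟩, rfl⟩
  · intro p
    obtain ⟨c, V, hV, -, hc, hcV, hp⟩ := exists_basicSet p Filter.univ_mem
    refine ⟨_, (isTopologicalBasis_basicSets C).isOpen ⟨c, V, hV, hc, hcV, rfl⟩, hp, ?_⟩
    rintro ⟨x, ζ, hζ⟩ hq ⟨x', ζ', hζ'⟩ hq' (rfl : x = x')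
    have : ζ = ζ' := hq.2.trans hq'.2.symm
    subst this
    rfl

/-- The spectral sheaf `E_sp(C)`, whose stalk at `x` is `G(C_x)`. -/
def spec : Sh n M := Sh.ofEtale (specProj C) (specProj_isLocalHomeomorph C)

variable {C} {D : CoAlg.{u} (Cc n M 𝕜)}

/-- Homomorphisms of coalgebras preserve grouplike elements of the local coalgebras. -/
theorem stalkMap_mem_grouplike (α : CoAlg.Hom C D) {x : M} {ζ : Stalk n 𝕜 x C.carrier}
    (hζ : ζ ∈ grouplike C x) : stalkMap x α.lin ζ ∈ grouplike D x := by
  obtain ⟨h1, h2⟩ := hζ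
  obtain ⟨c, rfl⟩ := stalkHom_surjective x ζ
  refine ⟨?_, ?_⟩
  · rw [localComul_stalkHom] at h1
    rw [stalkMap_stalkHom, localComul_stalkHom, α.comul_lin, ← BTensor.map_comp]
    have := congrArg (BTensor.map (stalkMap x α.lin) (stalkMap x α.lin)) h1
    rw [← BTensor.map_comp, BTensor.map_tmul, stalkMap_stalkHom] at this
    exact this
  · rw [stalkMap_stalkHom, localCounit_stalkHom, α.counit_lin]
    exact h2

/-- The map `E_sp(C) → E_sp(D)` given on the stalks by `α_x`. -/
def specMapFun (α : CoAlg.Hom C D) (p : SpecTotal C) : SpecTotal D :=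
  ⟨p.1, stalkMap p.1 α.lin p.2, stalkMap_mem_grouplike α p.2.2⟩

theorem specMapFun_continuous (α : CoAlg.Hom C D) : Continuous (specMapFun α) := by
  refine continuous_generateFrom_iff.2 ?_
  rintro _ ⟨d, V, hV, hd, hdV, rfl⟩
  refine (isTopologicalBasis_basicSets C).isOpen_iff.2 ?_
  rintro p ⟨hpV, hpd⟩
  obtain ⟨c, W, hW, -, hc, hcW, hpW⟩ := exists_basicSet p Filter.univ_mem
  have h1 : stalkHom n 𝕜 p.1 (α.lin c) = stalkHom n 𝕜 p.1 d := by
    rw [← stalkMap_stalkHom, ← hpW.2]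
    exact hpd
  obtain ⟨T, hT, hTo, hpT⟩ := mem_nhds_iff.1 (eventually_stalk_eq h1)
  refine ⟨_, ⟨c, T ∩ (W ∩ V), hTo.inter (hW.inter hV), hc, fun x hx => hcW x hx.2.1, rfl⟩,
    ⟨⟨hpT, hpW.1, hpV⟩, hpW.2⟩, ?_⟩
  rintro q ⟨⟨hqT, hqW, hqV⟩, hqc⟩
  refine ⟨hqV, ?_⟩
  change stalkMap q.1 α.lin (q.2 : Stalk n 𝕜 q.1 C.carrier) = stalkHom n 𝕜 q.1 d
  rw [hqc, stalkMap_stalkHom]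
  exact hT hqT

/-- The morphism of sheaves `E_sp(α)`. -/
def specMap (α : CoAlg.Hom C D) : Sh.Hom (spec C) (spec D) :=
  Sh.homOfContinuous (E := spec C) (F := spec D) (specMapFun α) (specMapFun_continuous α)
    (fun _ => rfl)

variable (n M 𝕜) in
/-- The spectral sheaf functor `E_sp` from coalgebras over `C_c^∞(M)` to sheaves on `M`. -/
def specFunctor : CoAlg.{u} (Cc n M 𝕜) ⥤ Sh n M where
  obj C := spec C
  map α := specMap α
  map_id C := by
    refine Sh.Hom.ext (funext ?_)
    rintro ⟨x, ζ, hζ⟩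
    obtain ⟨c, rfl⟩ := stalkHom_surjective x ζ
    rfl
  map_comp α β := by
    refine Sh.Hom.ext (funext ?_)
    rintro ⟨x, ζ, hζ⟩
    obtain ⟨c, rfl⟩ := stalkHom_surjective x ζ
    rfl

end Spectral

end SheafCoalg

/-! A morphism `E → E_sp(C)` over `M` is a family of grouplike germs of `C` at the points
`E.proj y`, locally induced by elements of `C`. An `R`-linear map `C_c^∞(E) → C` is determined by
the images of the germs `δ_y` of the functions equal to one near `y`, and these images form a
family locally induced by elements of `C`. Conversely every such family comes from a linear map:
for `u ∈ C_c^∞(E)` the germs `∑ u_y • τ_y`, summed over the fibres of `E`, are again locally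
induced by elements of `C`, and they glue to one element since `u` has compact support. Since the
germs `δ_y` are grouplike and generate, the linear map respects `Δ` and `ε` if and only if the
family consists of grouplike germs. This bijection is the adjunction, and its unit is `y ↦ δ_y`.

Full faithfulness says that the unit is bijective: every grouplike germ `u` of `C_c^∞(E)` at `x`
is some `δ_y`. Comparing `diag_+ u` with `Ω(u ⊗ u)` on the diagonal shows that every germ `u_y` is
idempotent, hence `0` or `1`, and off the diagonal that `u_y` and `u_z` are not both `1` for
`y ≠ z`; finally `ε(u) = 1` excludes that all the germs `u_y` over `x` vanish. -/

namespace SheafCoalg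

noncomputable section Adjunction

theorem IsLocallyUnitary.bTensor {R C D : Type*} [NonUnitalCommRing R] [AddCommGroup C]
    [AddCommGroup D] [NUModule R C] [NUModule R D] (hC : IsLocallyUnitary R C) :
    IsLocallyUnitary R (BTensor R C D) := by
  refine isLocallyUnitary_of_forall fun t => ?_
  induction t using BTensor.induction_on with
  | h0 => exact ⟨0, nu_smul_zero _⟩
  | h1 c d =>
    obtain ⟨r, hr⟩ := hC {c}
    exact ⟨r, by rw [BTensor.smul_def_tmul, hr c (Finset.mem_singleton_self c)]⟩
  | h2 s t hs ht =>
    obtain ⟨r, hr⟩ := hs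
    obtain ⟨r', hr'⟩ := ht
    refine ⟨r + r' - r * r', ?_⟩
    simp only [nu_smul_add, nu_sub_smul, nu_add_smul, nu_mul_smul, hr', nu_smul_comm r r', hr]
    abel

theorem eq_zero_or_eq_one_of_isIdempotentElem_germ {X A : Type*} [TopologicalSpace X]
    [TopologicalSpace A] [T1Space A] [MonoidWithZero A] [IsLeftCancelMulZero A] [Nontrivial A]
    {y : X} {g : X → A} (hg : ContinuousAt g y) (h : IsIdempotentElem (g : Germ (𝓝 y) A)) :
    (g : Germ (𝓝 y) A) = 0 ∨ (g : Germ (𝓝 y) A) = 1 := by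
  have h01 : ∀ᶠ z in 𝓝 y, g z = 0 ∨ g z = 1 :=
    (Germ.coe_eq.1 h).mono fun z hz => IsIdempotentElem.iff_eq_zero_or_one.1 hz
  rcases h01.self_of_nhds with hy | hy
  · left
    refine Germ.coe_eq.2 ?_
    filter_upwards [h01, hg.eventually_ne (hy.trans_ne zero_ne_one)] with z hz hne
    exact hz.resolve_right hne
  · right
    refine Germ.coe_eq.2 ?_
    filter_upwards [h01, hg.eventually_ne (hy.trans_ne one_ne_zero)] with z hz hne
    exact hz.resolve_left hne

theorem value_pullGerm {𝕜 : Type} {X Y : Type*} [TopologicalSpace X] [TopologicalSpace Y]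
    {φ : X → Y} (hφ : Continuous φ) (y : X) (g : Germ (𝓝 (φ y)) 𝕜) :
    (pullGerm hφ y g).value = g.value := by
  induction g using Germ.inductionOn with | _ g => rfl

variable {n : ℕ} {M : Type u} [TopologicalSpace M] [ChartedSpace (EuclideanSpace ℝ (Fin n)) M]

section Sheaves

variable {E F : Sh n M}

theorem Sh.Hom.isIso_of_bijective (φ : E ⟶ F) (h : Function.Bijective (Sh.Hom.toFun φ)) :
    IsIso φ := by
  let e := (Equiv.ofBijective _ h).toHomeomorphOfContinuousOpen
    (Sh.Hom.smooth φ).continuous (Sh.Hom.isLocalHomeomorph φ).isOpenMap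
  have hproj (z : F.Total) : E.proj (e.symm z) = F.proj z :=
    (Sh.Hom.proj_toFun φ (e.symm z)).symm.trans (congrArg F.proj (e.apply_symm_apply z))
  exact ⟨Sh.homOfContinuous (E := F) (F := E) e.symm e.symm.continuous hproj,
    Sh.Hom.ext (funext e.symm_apply_apply), Sh.Hom.ext (funext e.apply_symm_apply)⟩

variable {𝕜 : Type} [RCLike 𝕜]

section FibreProducts

variable [IsManifold (𝓡 n) ∞ M]

theorem value_omegaSec (u : ∀ y : E.Total, Germ (𝓝 y) 𝕜) (v : ∀ z : F.Total, Germ (𝓝 z) 𝕜)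
    (p : (E.prod F).Total) : (omegaSec u v p).value =
      (u ((Sh.fst E F).toFun p)).value * (v ((Sh.snd E F).toFun p)).value := by
  rw [omegaSec, ← value_pullGerm (Sh.fst E F).smooth.continuous p,
    ← value_pullGerm (Sh.snd E F).smooth.continuous p]
  exact map_mul Germ.valueMulHom _ _

theorem pullGerm_diag_omegaSec (u v : ∀ y : E.Total, Germ (𝓝 y) 𝕜) (y : E.Total) :
    pullGerm E.diag.smooth.continuous y (omegaSec u v (E.diag.toFun y)) = u y * v y := by
  change pullGerm E.diag.smooth.continuous y
    (pullGerm (y := E.diag.toFun y) (φ := (Sh.fst E E).toFun) (Sh.fst E E).smooth.continuous (u y) *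
      pullGerm (y := E.diag.toFun y) (φ := (Sh.snd E E).toFun) (Sh.snd E E).smooth.continuous
        (v y)) = _
  generalize u y = g, v y = g'
  induction g using Germ.inductionOn with | _ g =>
  induction g' using Germ.inductionOn with | _ g' =>
  rfl

end FibreProducts

section Sections

variable [T2Space M]

theorem Sh.Fn.exists_continuous_sec (u : E.Fn 𝕜) (y : E.Total) :
    ∃ g : E.Total → 𝕜, Continuous g ∧ u.sec y = (g : Germ (𝓝 y) 𝕜) := by
  induction u using Sh.Fn.induction with
  | h0 => exact ⟨0, continuous_zero, by rw [map_zero]; rfl⟩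
  | hel U f h =>
    by_cases hy : y ∈ U
    · exact ⟨_, (Cc.smooth f).continuous.comp E.isLocalHomeomorph.continuous,
        by rw [elF_sec, el_mem f hy]⟩
    · exact ⟨0, continuous_zero, by rw [elF_sec, el_not_mem f hy]; rfl⟩
  | hadd u v hu hv =>
    obtain ⟨f, hf, hfu⟩ := hu
    obtain ⟨g, hg, hgv⟩ := hv
    exact ⟨f + g, hf.add hg, by rw [map_add, Pi.add_apply, hfu, hgv]; rfl⟩

theorem smul_sec_of_eventually_eq_one {f : Cc n M 𝕜} {y : E.Total}
    (hf : ∀ᶠ z in 𝓝 (E.proj y), f.1 z = 1) (u : E.Fn 𝕜) : (f • u).sec y = u.sec y := by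
  have hgerm : ((f.1 ∘ E.proj : E.Total → 𝕜) : Germ (𝓝 y) 𝕜) = 1 :=
    Germ.coe_eq.2 (E.isLocalHomeomorph.continuous.continuousAt.eventually hf)
  rw [Sh.Fn.smul_sec, smulSec, hgerm, one_mul]

theorem pullGerm_push_sec (φ : Sh.Hom E F) (hφ : Function.Injective φ.toFun) (u : E.Fn 𝕜)
    (y : E.Total) : pullGerm φ.smooth.continuous y ((φ.push 𝕜 u).sec (φ.toFun y)) = u.sec y := by
  induction u using Sh.Fn.induction with
  | h0 => simp only [map_zero]; rfl
  | hadd u v hu hv => simp only [map_add, Pi.add_apply, pullGerm_add, hu, hv]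
  | hel U f h =>
    rw [φ.push_elF, elF_sec, elF_sec]
    by_cases hy : y ∈ U
    · rw [el_mem f hy, el_mem f (Set.mem_image_of_mem _ hy)]
      exact Germ.coe_eq.2 (Eventually.of_forall fun w => congrArg f.1 (φ.proj_toFun w))
    · rw [el_not_mem f hy, el_not_mem f (hφ.mem_set_image.not.2 hy)]
      rfl

theorem push_sec_of_notMem_range (φ : Sh.Hom E F) (u : E.Fn 𝕜) {z : F.Total}
    (hz : z ∉ Set.range φ.toFun) : (φ.push 𝕜 u).sec z = 0 :=
  have : IsEmpty {y : E.Total // φ.toFun y = z} := ⟨fun y => hz ⟨y.1, y.2⟩⟩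
  finsum_of_isEmpty _

end Sections

end Sheaves

variable [IsManifold (𝓡 n) ∞ M] [T2Space M] {𝕜 : Type} [RCLike 𝕜]

section Germs

variable {C : Type*} [AddCommGroup C] [NUModule (Cc n M 𝕜) C]

theorem isLocallyUnitary_cc : IsLocallyUnitary (Cc n M 𝕜) (Cc n M 𝕜) :=
  isLocallyUnitary_of_forall fun f =>
    (exists_local_unit f isOpen_univ (Set.subset_univ _)).imp fun _ h => h.2

theorem IsLocallyUnitary.ext_stalk (hC : IsLocallyUnitary (Cc n M 𝕜) C) {c d : C}
    (h : ∀ x : M, stalkHom n 𝕜 x c = stalkHom n 𝕜 x d) : c = d := by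
  obtain ⟨r, hr⟩ := hC {c - d}
  refine sub_eq_zero.1 (eq_zero_of_stalk r (hr _ (Finset.mem_singleton_self _)) fun x => ?_)
  rw [map_sub, h, sub_self]

theorem stalk_smul_eq_zero {x : M} {f : Cc n M 𝕜} (hf : x ∉ tsupport f.1) (t : Stalk n 𝕜 x C) :
    f • t = 0 := by
  rw [stalk_smul_congr (g := 0) (Cc.eventually_zero f hf), nu_zero_smul]

theorem stalkHom_cc_eq {x : M} {f g : Cc n M 𝕜} (h : (f.1 : Germ (𝓝 x) 𝕜) = g.1) :
    stalkHom n 𝕜 x f = stalkHom n 𝕜 x g := by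
  obtain ⟨ρ, hρ, hρ1⟩ := exists_bump (n := n) 𝕜 x (Germ.coe_eq.1 h)
  refine stalkHom_eq.2 ⟨ρ, hρ1, ?_⟩
  ext z
  by_cases hz : z ∈ tsupport ρ.1
  · have hfg : f.1 z = g.1 z := hρ hz
    simp [hfg]
  · simp [image_eq_zero_of_notMem_tsupport hz]

/-- A family of germs of elements of `C` at the points `p y` of `M` is continuous if it is locally
given by elements of `C`; these are the continuous lifts of `p` to the étale space of `C`. -/
def IsContinuousFamily {Y : Type*} [TopologicalSpace Y] (p : Y → M)
    (τ : ∀ y, Stalk n 𝕜 (p y) C) : Prop :=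
  ∀ y₀, ∃ c : C, ∀ᶠ y in 𝓝 y₀, τ y = stalkHom n 𝕜 (p y) c

section Gluing

variable {s : ∀ x : M, Stalk n 𝕜 x C}

theorem exists_bump_smul_eq_stalkHom {x : M} {c : C} (hc : ∀ᶠ z in 𝓝 x, s z = stalkHom n 𝕜 z c) :
    ∃ ρ : Cc n M 𝕜, (∀ᶠ z in 𝓝 x, ρ.1 z = 1) ∧ ∃ d : C, ∀ z, stalkHom n 𝕜 z d = ρ • s z := by
  obtain ⟨ρ, hρ, hρ1⟩ := exists_bump (n := n) 𝕜 x hc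
  refine ⟨ρ, hρ1, ρ • c, fun z => ?_⟩
  by_cases hz : z ∈ tsupport ρ.1
  · rw [← smul_stalkHom, hρ hz]
  · rw [← smul_stalkHom, stalk_smul_eq_zero hz, stalk_smul_eq_zero hz]

theorem IsContinuousFamily.exists_smul_eq_stalkHom
    (hs : IsContinuousFamily (fun x : M => x) s) {K : Set M} (hK : IsCompact K) :
    ∃ ρ : Cc n M 𝕜, (∀ x ∈ K, ρ.1 x = 1) ∧ ∃ c : C, ∀ x, stalkHom n 𝕜 x c = ρ • s x := by
  refine hK.induction_on (p := fun K => ∃ ρ : Cc n M 𝕜, (∀ x ∈ K, ρ.1 x = 1) ∧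
    ∃ c : C, ∀ x, stalkHom n 𝕜 x c = ρ • s x) ?empty ?mono ?union ?nhds
  case empty => exact ⟨0, by simp, 0, fun x => by rw [map_zero, nu_zero_smul]⟩
  case mono =>
    rintro K L hKL ⟨ρ, hρ, hc⟩
    exact ⟨ρ, fun x hx => hρ x (hKL hx), hc⟩
  case union =>
    rintro K L ⟨ρ, hρ, c, hc⟩ ⟨σ, hσ, d, hd⟩
    refine ⟨ρ + σ - ρ * σ, ?_, c + d - ρ • d, fun x => ?_⟩
    · rintro x (hx | hx)
      · simp [hρ x hx]
      · simp [hσ x hx]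
    · rw [map_sub, map_add, ← smul_stalkHom, hc, hd, nu_sub_smul, nu_add_smul, nu_mul_smul]
  case nhds =>
    intro x _
    obtain ⟨c, hc⟩ := hs x
    obtain ⟨ρ, hρ, hd⟩ := exists_bump_smul_eq_stalkHom hc
    exact ⟨_, mem_nhdsWithin_of_mem_nhds hρ, ρ, fun z hz => hz, hd⟩

theorem IsContinuousFamily.exists_eq_stalkHom (hs : IsContinuousFamily (fun x : M => x) s)
    (r : Cc n M 𝕜) (hr : ∀ x, r • s x = s x) : ∃ c : C, ∀ x, stalkHom n 𝕜 x c = s x := by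
  obtain ⟨ρ, hρ, c, hc⟩ := hs.exists_smul_eq_stalkHom (Cc.compact r).isCompact
  have hrρ : r * ρ = r := by
    ext x
    by_cases hx : x ∈ tsupport r.1
    · simp [hρ x hx]
    · simp [image_eq_zero_of_notMem_tsupport hx]
  exact ⟨r • c, fun x => by rw [← smul_stalkHom, hc, ← nu_mul_smul, hrρ, hr]⟩

end Gluing

end Germs

section LinearMaps

variable {E : Sh n M} {C : Type*} [AddCommGroup C] [NUModule (Cc n M 𝕜) C]

variable (𝕜) in
/-- An elementary function on `E` equal to one near `y`: the generator `δ_y` of the germs at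
`E.proj y` of the elements of `C_c^∞(E)` supported near `y`. -/
def delta (y : E.Total) : E.Fn 𝕜 := unitAt (E.proj y) ⟨y, rfl⟩

theorem stalkHom_smul_delta {U : Set E.Total} {f : Cc n M 𝕜} (h : IsEl E U f) {y : E.Total}
    (hy : y ∈ U) : f • stalkHom n 𝕜 (E.proj y) (delta 𝕜 y) = stalkHom n 𝕜 (E.proj y) (elF h) :=
  stalk_elF_unitAt h _ ⟨y, rfl⟩ hy

theorem exists_delta_eq_elF (y : E.Total) : ∃ (U : Set E.Total) (η : Cc n M 𝕜) (h : IsEl E U η),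
    y ∈ U ∧ (∀ᶠ x in 𝓝 (E.proj y), η.1 x = 1) ∧ delta 𝕜 y = elF h :=
  have h := (exists_elementary_bump 𝕜 (E.proj y) ⟨y, rfl⟩).choose_spec.choose_spec
  ⟨_, _, h.1, h.2.1, h.2.2, rfl⟩

theorem stalkHom_delta {U : Set E.Total} {f : Cc n M 𝕜} (h : IsEl E U f) {y : E.Total}
    (hy : y ∈ U) (hf : ∀ᶠ x in 𝓝 (E.proj y), f.1 x = 1) :
    stalkHom n 𝕜 (E.proj y) (delta 𝕜 y) = stalkHom n 𝕜 (E.proj y) (elF h) := by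
  rw [← stalkHom_smul_delta h hy, stalk_smul_one hf]

theorem eventually_stalkHom_delta {U : Set E.Total} {f : Cc n M 𝕜} (h : IsEl E U f) {y : E.Total}
    (hy : y ∈ U) (hf : ∀ᶠ x in 𝓝 (E.proj y), f.1 x = 1) : ∀ᶠ z in 𝓝 y,
      stalkHom n 𝕜 (E.proj z) (delta 𝕜 z) = stalkHom n 𝕜 (E.proj z) (elF h) := by
  filter_upwards [h.isOpen.mem_nhds hy,
    E.isLocalHomeomorph.continuous.continuousAt.eventually hf.eventually_nhds] with z hz hfz
  exact stalkHom_delta h hz hfz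

/-- The germ at `x` of the family `τ` weighted by `u ∈ C_c^∞(E)`: the sum of the germs
`u_y • τ y` over the points `y` of `E` over `x`. -/
def germSum (τ : ∀ y : E.Total, Stalk n 𝕜 (E.proj y) C) (x : M) (u : E.Fn 𝕜) : Stalk n 𝕜 x C :=
  theta x (fun y => y.2 ▸ τ y.1) u

variable {τ : ∀ y : E.Total, Stalk n 𝕜 (E.proj y) C}

theorem germSum_zero (x : M) : germSum τ x 0 = 0 := theta_zero _ _

theorem germSum_add (x : M) (u v : E.Fn 𝕜) :
    germSum τ x (u + v) = germSum τ x u + germSum τ x v := theta_add _ _ _ _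

theorem germSum_elF_of_mem {U : Set E.Total} {f : Cc n M 𝕜} (h : IsEl E U f) {y : E.Total}
    (hy : y ∈ U) : germSum τ (E.proj y) (elF h) = f • τ y :=
  theta_elF_mem _ _ h ⟨y, rfl⟩ hy

theorem germSum_elF_of_notMem {U : Set E.Total} {f : Cc n M 𝕜} (h : IsEl E U f) {x : M}
    (hx : x ∉ E.proj '' U) : germSum τ x (elF h) = 0 :=
  theta_elF_not_mem _ _ h fun y hy hyx => hx ⟨y, hy, hyx⟩

theorem germSum_smul (x : M) (r : Cc n M 𝕜) (u : E.Fn 𝕜) :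
    germSum τ x (r • u) = r • germSum τ x u := by
  induction u using Sh.Fn.induction with
  | h0 => rw [nu_smul_zero, germSum_zero, nu_smul_zero]
  | hadd u v hu hv => rw [nu_smul_add, germSum_add, germSum_add, nu_smul_add, hu, hv]
  | hel U f h =>
    rw [smul_elF]
    by_cases hx : x ∈ E.proj '' U
    · obtain ⟨y, hy, rfl⟩ := hx
      rw [germSum_elF_of_mem _ hy, germSum_elF_of_mem _ hy, nu_mul_smul]
    · rw [germSum_elF_of_notMem _ hx, germSum_elF_of_notMem _ hx, nu_smul_zero]

theorem stalkHom_eq_germSum (α : NULin (Cc n M 𝕜) (E.Fn 𝕜) C) (x : M) (u : E.Fn 𝕜) :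
    stalkHom n 𝕜 x (α u) = germSum (fun y => stalkHom n 𝕜 (E.proj y) (α (delta 𝕜 y))) x u := by
  induction u using Sh.Fn.induction with
  | h0 => rw [germSum_zero, map_zero, map_zero]
  | hadd u v hu hv => rw [germSum_add, map_add, map_add, hu, hv]
  | hel U f h =>
    by_cases hx : x ∈ E.proj '' U
    · obtain ⟨y, hy, rfl⟩ := hx
      rw [germSum_elF_of_mem h hy, ← stalkMap_stalkHom, ← stalkHom_smul_delta h hy,
        NULin.map_smul, stalkMap_stalkHom]
    · rw [germSum_elF_of_notMem h hx, ← stalkMap_stalkHom,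
        stalk_elF_zero h fun y hy hyx => hx ⟨y, hy, hyx⟩, map_zero]

theorem NULin.ext_delta (hC : IsLocallyUnitary (Cc n M 𝕜) C) {α β : NULin (Cc n M 𝕜) (E.Fn 𝕜) C}
    (h : ∀ y, stalkHom n 𝕜 (E.proj y) (α (delta 𝕜 y)) = stalkHom n 𝕜 (E.proj y) (β (delta 𝕜 y))) :
    α = β :=
  NULin.ext fun u => hC.ext_stalk fun x => by
    rw [stalkHom_eq_germSum, stalkHom_eq_germSum, funext h]

theorem isContinuousFamily_delta (α : NULin (Cc n M 𝕜) (E.Fn 𝕜) C) :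
    IsContinuousFamily E.proj fun y => stalkHom n 𝕜 (E.proj y) (α (delta 𝕜 y)) := fun y => by
  obtain ⟨U, η, h, hy, hη, -⟩ := exists_delta_eq_elF (𝕜 := 𝕜) y
  refine ⟨α (elF h), (eventually_stalkHom_delta h hy hη).mono fun z hz => ?_⟩
  exact congrArg (stalkMap (E.proj z) α) hz

theorem IsContinuousFamily.germSum (hτ : IsContinuousFamily E.proj τ) (u : E.Fn 𝕜) :
    IsContinuousFamily (fun x : M => x) fun x => germSum τ x u := by
  intro x
  induction u using Sh.Fn.induction with
  | h0 => exact ⟨0, Eventually.of_forall fun z => by simp only [germSum_zero, map_zero]⟩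
  | hadd u v hu hv =>
    obtain ⟨c, hc⟩ := hu
    obtain ⟨d, hd⟩ := hv
    refine ⟨c + d, ?_⟩
    filter_upwards [hc, hd] with z hcz hdz
    simp only [germSum_add, map_add, hcz, hdz]
  | hel U f h =>
    by_cases hx : x ∈ E.proj '' U
    · obtain ⟨y, hy, rfl⟩ := hx
      obtain ⟨c, hc⟩ := hτ y
      refine ⟨f • c, ?_⟩
      rw [← E.isLocalHomeomorph.map_nhds_eq y, eventually_map]
      filter_upwards [hc, h.isOpen.mem_nhds hy] with z hcz hz
      rw [germSum_elF_of_mem h hz, hcz, smul_stalkHom]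
    · refine ⟨0, ?_⟩
      have hxf : x ∉ tsupport f.1 := fun hxf => hx (h.supp hxf)
      filter_upwards [(isClosed_tsupport f.1).isOpen_compl.mem_nhds hxf] with z hz
      rw [map_zero]
      by_cases hzU : z ∈ E.proj '' U
      · obtain ⟨w, hw, rfl⟩ := hzU
        rw [germSum_elF_of_mem h hw, stalk_smul_eq_zero hz]
      · exact germSum_elF_of_notMem h hzU

theorem IsContinuousFamily.exists_stalkHom_eq_germSum (hτ : IsContinuousFamily E.proj τ)
    (u : E.Fn 𝕜) : ∃ c : C, ∀ x, stalkHom n 𝕜 x c = SheafCoalg.germSum τ x u := by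
  obtain ⟨r, hr⟩ := Sh.Fn.isLocallyUnitary E {u}
  refine (hτ.germSum u).exists_eq_stalkHom r fun x => ?_
  rw [← germSum_smul, hr u (Finset.mem_singleton_self u)]

theorem IsContinuousFamily.exists_linearMap (hτ : IsContinuousFamily E.proj τ)
    (hC : IsLocallyUnitary (Cc n M 𝕜) C) : ∃ α : NULin (Cc n M 𝕜) (E.Fn 𝕜) C,
      ∀ y, stalkHom n 𝕜 (E.proj y) (α (delta 𝕜 y)) = τ y := by
  choose α hα using hτ.exists_stalkHom_eq_germSum
  refine ⟨{ toAddMonoidHom := AddMonoidHom.mk' α fun u v => hC.ext_stalk fun x => ?add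
            map_smul' := fun r u => hC.ext_stalk fun x => ?smul }, fun y => ?delta⟩
  case add => rw [map_add, hα, hα, hα, germSum_add]
  case smul => exact (hα _ x).trans (by rw [germSum_smul, ← hα, smul_stalkHom]; rfl)
  case delta =>
    obtain ⟨U, η, h, hy, hη, hδ⟩ := exists_delta_eq_elF (𝕜 := 𝕜) y
    exact (hα _ _).trans (by rw [hδ, germSum_elF_of_mem h hy, stalk_smul_one hη])

end LinearMaps

section Grouplike

variable {E : Sh n M} {C : CoAlg.{u} (Cc n M 𝕜)}

theorem stalkHom_comul_of_mem_grouplike {x : M} {c : C.carrier}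
    (hc : stalkHom n 𝕜 x c ∈ grouplike C x) :
    stalkHom n 𝕜 x (C.comul c) = stalkHom n 𝕜 x (BTensor.tmul (Cc n M 𝕜) c c) := by
  rw [← stalkTensor_map, ← stalkTensor_map, ← localComul_stalkHom, hc.1]
  rfl

theorem stalkHom_delta_mem_grouplike (y : E.Total) :
    stalkHom n 𝕜 (E.proj y) (delta 𝕜 y) ∈ grouplike (E.coalg 𝕜) (E.proj y) := by
  obtain ⟨U, η, h, -, hη, hδ⟩ := exists_delta_eq_elF (𝕜 := 𝕜) y
  obtain ⟨ρ, hρ, hρη⟩ := h.exists_unit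
  have hweak : IsWeaklyGrouplike (C := E.coalg 𝕜) (elF h) := ⟨elF hρ, E.comul_elF h hρ hρη⟩
  rw [hδ]
  refine hweak.stalk_mem ((congrArg (fun f : Cc n M 𝕜 => (f.1 : Germ (𝓝 (E.proj y)) 𝕜))
    (E.counit_elF h)).trans (Germ.coe_eq.2 hη))

variable {α : NULin (Cc n M 𝕜) (E.Fn 𝕜) C.carrier}
  (hα : ∀ y, stalkHom n 𝕜 (E.proj y) (α (delta 𝕜 y)) ∈ grouplike C (E.proj y))
include hα

theorem comul_comp_eq_of_forall_mem_grouplike :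
    C.comul.comp α = (BTensor.map α α).comp (E.comul 𝕜) := by
  refine NULin.ext_delta C.locallyUnitary.bTensor fun y => ?_
  have hδ : stalkHom n 𝕜 (E.proj y) (E.comul 𝕜 (delta 𝕜 y)) =
      stalkHom n 𝕜 (E.proj y) (BTensor.tmul (Cc n M 𝕜) (delta 𝕜 y) (delta 𝕜 y)) :=
    stalkHom_comul_of_mem_grouplike (C := E.coalg 𝕜) (stalkHom_delta_mem_grouplike y)
  rw [NULin.comp_apply, stalkHom_comul_of_mem_grouplike (hα y), ← BTensor.map_tmul]
  exact (congrArg (stalkMap (E.proj y) (BTensor.map α α)) hδ).symm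

theorem counit_comp_eq_of_forall_mem_grouplike : C.counit.comp α = E.counit 𝕜 :=
  NULin.ext_delta isLocallyUnitary_cc fun y =>
    stalkHom_cc_eq ((hα y).2.trans (stalkHom_delta_mem_grouplike y).2.symm)

omit hα in
/-- A linear map `C_c^∞(E) → C` that sends the germs `δ_y` to grouplike germs, as a homomorphism of
coalgebras. -/
def coalgHomOfGrouplike (α : NULin (Cc n M 𝕜) (E.Fn 𝕜) C.carrier)
    (hα : ∀ y, stalkHom n 𝕜 (E.proj y) (α (delta 𝕜 y)) ∈ grouplike C (E.proj y)) :
    CoAlg.Hom (E.coalg 𝕜) C where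
  lin := α
  comul_lin u := congrArg (fun β : NULin (Cc n M 𝕜) (E.Fn 𝕜) _ => β u)
    (comul_comp_eq_of_forall_mem_grouplike hα)
  counit_lin u := congrArg (fun β : NULin (Cc n M 𝕜) (E.Fn 𝕜) _ => β u)
    (counit_comp_eq_of_forall_mem_grouplike hα)

end Grouplike

section HomEquiv

variable {E F : Sh n M} {C : CoAlg.{u} (Cc n M 𝕜)}

theorem SpecTotal.ext {p q : SpecTotal C} (h : p.1 = q.1) (c : C.carrier)
    (hp : p.2.1 = stalkHom n 𝕜 p.1 c) (hq : q.2.1 = stalkHom n 𝕜 q.1 c) : p = q := by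
  obtain ⟨x, ζ, hζ⟩ := p
  obtain ⟨x', ζ', hζ'⟩ := q
  obtain rfl : x = x' := h
  obtain rfl : ζ = ζ' := hp.trans hq.symm
  rfl

theorem continuous_specTotal_iff {Y : Type*} [TopologicalSpace Y] {φ : Y → SpecTotal C} :
    Continuous φ ↔ Continuous (fun y => (φ y).1) ∧
      IsContinuousFamily (fun y => (φ y).1) fun y => (φ y).2.1 := by
  constructor
  · refine fun hφ => ⟨(specProj_isLocalHomeomorph C).continuous.comp hφ, fun y => ?_⟩
    obtain ⟨c, V, hV, -, hc, hcV, hy⟩ := exists_basicSet (φ y) univ_mem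
    have hopen := (isTopologicalBasis_basicSets C).isOpen ⟨c, V, hV, hc, hcV, rfl⟩
    exact ⟨c, (hφ.continuousAt.eventually (hopen.mem_nhds hy)).mono fun z hz => hz.2⟩
  · rintro ⟨hp, hτ⟩
    refine continuous_generateFrom_iff.2 ?_
    rintro _ ⟨c, V, hV, -, -, rfl⟩
    refine isOpen_iff_mem_nhds.2 fun y ⟨hyV, hyc⟩ => ?_
    obtain ⟨d, hd⟩ := hτ y
    have hdc := hd.self_of_nhds.symm.trans hyc
    filter_upwards [hd, hp.continuousAt.eventually
      ((hV.eventually_mem hyV).and (eventually_stalk_eq hdc))] with z hz ⟨hzV, hzc⟩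
    exact ⟨hzV, hz.trans hzc⟩

theorem exists_isContinuousFamily_of_continuous {φ : E.Total → SpecTotal C} (hφ : Continuous φ)
    (h : ∀ y, (φ y).1 = E.proj y) : ∃ τ : ∀ y, grouplike C (E.proj y),
      IsContinuousFamily E.proj (fun y => (τ y).1) ∧ φ = fun y => ⟨E.proj y, τ y⟩ := by
  have hτ := (continuous_specTotal_iff.1 hφ).2
  generalize E.proj = p at h ⊢
  obtain rfl : (fun y => (φ y).1) = p := funext h
  exact ⟨fun y => (φ y).2, hτ, rfl⟩

/-- The transpose `E → E_sp(C)` of a homomorphism `α : C_c^∞(E) → C`, given by `y ↦ α_x(δ_y)` over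
`x = E.proj y`. -/
def toSpec (α : CoAlg.Hom (E.coalg 𝕜) C) : Sh.Hom E (spec C) :=
  Sh.homOfContinuous (F := spec C)
    (fun y => (⟨E.proj y, stalkMap (E.proj y) α.lin (stalkHom n 𝕜 (E.proj y) (delta 𝕜 y)),
      stalkMap_mem_grouplike α (stalkHom_delta_mem_grouplike y)⟩ : SpecTotal C))
    (continuous_specTotal_iff.2
      ⟨E.isLocalHomeomorph.continuous, isContinuousFamily_delta (C := C.carrier) α.lin⟩)
    fun _ => rfl

theorem toSpec_injective :
    Function.Injective (toSpec : CoAlg.Hom (E.coalg 𝕜) C → Sh.Hom E (spec C)) := fun _ _ h =>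
  CoAlg.Hom.ext <| NULin.ext_delta C.locallyUnitary fun y =>
    Subtype.ext_iff.1 (eq_of_heq (Sigma.ext_iff.1 (congrFun (congrArg Sh.Hom.toFun h) y)).2)

theorem toSpec_surjective :
    Function.Surjective (toSpec : CoAlg.Hom (E.coalg 𝕜) C → Sh.Hom E (spec C)) := fun φ => by
  obtain ⟨τ, hτ, hφ⟩ := exists_isContinuousFamily_of_continuous (C := C) φ.smooth.continuous
    φ.proj_toFun
  obtain ⟨α, hα⟩ := hτ.exists_linearMap C.locallyUnitary
  refine ⟨coalgHomOfGrouplike α fun y => ?_, Sh.Hom.ext ?_⟩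
  · rw [hα]
    exact (τ y).2
  · rw [hφ]
    exact funext fun y => Sigma.ext rfl (heq_of_eq (Subtype.ext (hα y)))

theorem toSpec_coalgHom_comp (φ : E ⟶ F) (α : F.coalg 𝕜 ⟶ C) :
    toSpec (Sh.Hom.coalgHom 𝕜 φ ≫ α) = φ ≫ toSpec α := by
  refine Sh.Hom.ext (funext fun y => ?_)
  obtain ⟨U, η, h, hy, hη, hδ⟩ := exists_delta_eq_elF (𝕜 := 𝕜) y
  have hφ : F.proj (φ.toFun y) = E.proj y := φ.proj_toFun y
  refine SpecTotal.ext (C := C) hφ.symm (α.lin (elF (h.image φ))) ?_ ?_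
  · refine congrArg (fun u => stalkHom n 𝕜 (E.proj y) (α.lin u)) ?_
    exact (congrArg (φ.push 𝕜) hδ).trans (φ.push_elF h)
  · refine congrArg (stalkMap _ α.lin) (stalkHom_delta (h.image φ) (Set.mem_image_of_mem _ hy) ?_)
    rwa [hφ]

/-- The bijection between homomorphisms of coalgebras `C_c^∞(E) → C` and morphisms of sheaves
`E → E_sp(C)`, by which the adjunction is defined. -/
def toSpecEquiv (E : Sh n M) (C : CoAlg.{u} (Cc n M 𝕜)) :
    (E.coalg 𝕜 ⟶ C) ≃ (E ⟶ spec C) :=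
  Equiv.ofBijective toSpec ⟨toSpec_injective, toSpec_surjective⟩

variable (n M 𝕜) in
/-- The adjunction between `C_c^∞` and `E_sp` given by the bijections `toSpecEquiv`. -/
def ccAdjunction : ccFunctor n M 𝕜 ⊣ specFunctor n M 𝕜 :=
  Adjunction.mkOfHomEquiv
    { homEquiv := toSpecEquiv
      homEquiv_naturality_left_symm := fun {E F C} φ ψ =>
        (toSpecEquiv E C).symm_apply_eq.2 <|
          (congrArg (φ ≫ ·) ((toSpecEquiv F C).apply_symm_apply ψ).symm).trans
            (toSpec_coalgHom_comp φ _).symm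
      homEquiv_naturality_right := fun _ _ => rfl }

end HomEquiv

section DeltaSections

variable {E : Sh n M}

theorem delta_sec_self (y : E.Total) : (delta 𝕜 y).sec y = 1 := by
  obtain ⟨U, η, h, hy, hη, hδ⟩ := exists_delta_eq_elF (𝕜 := 𝕜) y
  rw [hδ, elF_sec, el_mem η hy]
  exact Germ.coe_eq.2 (E.isLocalHomeomorph.continuous.continuousAt.eventually hη)

theorem delta_sec_of_ne {y z : E.Total} (hz : E.proj z = E.proj y) (hne : z ≠ y) :
    (delta 𝕜 y).sec z = 0 := by
  obtain ⟨U, η, h, hy, -, hδ⟩ := exists_delta_eq_elF (𝕜 := 𝕜) y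
  rw [hδ, elF_sec, el_not_mem η fun hzU => hne (h.injOn hzU hy hz)]

theorem stalkHom_eq_iff_sec_eq {x : M} {u v : E.Fn 𝕜} :
    stalkHom n 𝕜 x u = stalkHom n 𝕜 x v ↔ ∀ y, E.proj y = x → u.sec y = v.sec y := by
  constructor
  · rintro h y rfl
    obtain ⟨f, hf, hfuv⟩ := stalkHom_eq.1 h
    rw [← smul_sec_of_eventually_eq_one hf u, hfuv, smul_sec_of_eventually_eq_one hf v]
  · intro h
    refine (stalkHom_eq_germSum (NULin.id _) x u).trans
      (Eq.trans ?_ (stalkHom_eq_germSum (NULin.id _) x v).symm)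
    exact finsum_congr fun y => by rw [h y.1 y.2]

end DeltaSections

section GrouplikeGerms

variable {E : Sh n M} {x : M} {u : E.Fn 𝕜} (hu : stalkHom n 𝕜 x u ∈ grouplike (E.coalg 𝕜) x)
include hu

theorem push_diag_sec_of_mem_grouplike {p : (E.prod E).Total} (hp : (E.prod E).proj p = x) :
    (E.diag.push 𝕜 u).sec p = omegaSec u.sec u.sec p := by
  have h : stalkHom n 𝕜 x (omega 𝕜 E E (E.comul 𝕜 u)) =
      stalkHom n 𝕜 x (omega 𝕜 E E (BTensor.tmul (Cc n M 𝕜) u u)) :=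
    congrArg (stalkMap x (omega 𝕜 E E)) (stalkHom_comul_of_mem_grouplike (C := E.coalg 𝕜) hu)
  rw [E.omega_comul, omega_tmul] at h
  exact stalkHom_eq_iff_sec_eq.1 h p hp

theorem sec_eq_zero_or_eq_one_of_mem_grouplike {y : E.Total} (hy : E.proj y = x) :
    u.sec y = 0 ∨ u.sec y = 1 := by
  have hidem : IsIdempotentElem (u.sec y) := by
    have hdiag := push_diag_sec_of_mem_grouplike hu (p := E.diag.toFun y)
      ((E.diag.proj_toFun y).trans hy)
    have hinj : Function.Injective E.diag.toFun := fun a b hab => congrArg (Sh.fst E E).toFun hab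
    rw [IsIdempotentElem, ← pullGerm_diag_omegaSec, ← hdiag, pullGerm_push_sec _ hinj]
  obtain ⟨g, hg, hug⟩ := u.exists_continuous_sec y
  rw [hug] at hidem ⊢
  exact eq_zero_or_eq_one_of_isIdempotentElem_germ hg.continuousAt hidem

theorem sec_eq_zero_of_mem_grouplike {y z : E.Total} (hy : E.proj y = x) (hz : E.proj z = x)
    (hzy : z ≠ y) (hy1 : u.sec y = 1) : u.sec z = 0 := by
  refine (sec_eq_zero_or_eq_one_of_mem_grouplike hu hz).resolve_right fun hz1 => ?_
  obtain ⟨p, rfl, rfl⟩ := exists_prod (hy.trans hz.symm)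
  have hp : p ∉ Set.range E.diag.toFun := by
    rintro ⟨w, rfl⟩
    exact hzy rfl
  have h := push_diag_sec_of_mem_grouplike hu ((proj_eq_fst p).trans hy)
  rw [push_sec_of_notMem_range _ _ hp] at h
  have hvalue := congrArg Germ.value h
  rw [value_omegaSec, hy1, hz1] at hvalue
  exact zero_ne_one (hvalue.trans (mul_one (1 : 𝕜)))

theorem exists_sec_eq_one_of_mem_grouplike : ∃ y, E.proj y = x ∧ u.sec y = 1 := by
  by_contra! hne
  have hzero : stalkHom n 𝕜 x u = stalkHom n 𝕜 x 0 := stalkHom_eq_iff_sec_eq.2 fun y hy =>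
    ((sec_eq_zero_or_eq_one_of_mem_grouplike hu hy).resolve_right (hne y hy)).trans
      (by rw [map_zero]; rfl)
  have hcounit : localCounit (E.coalg 𝕜) x (stalkHom n 𝕜 x u) = 0 :=
    (congrArg (localCounit (E.coalg 𝕜) x) hzero).trans (by
      rw [map_zero]
      exact map_zero (localCounit (E.coalg 𝕜) x))
  exact zero_ne_one (α := 𝕜) (congrArg Germ.value (hcounit.symm.trans hu.2))

theorem exists_stalkHom_eq_delta_of_mem_grouplike :
    ∃ y, E.proj y = x ∧ stalkHom n 𝕜 x u = stalkHom n 𝕜 x (delta 𝕜 y) := by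
  obtain ⟨y, rfl, hy⟩ := exists_sec_eq_one_of_mem_grouplike hu
  refine ⟨y, rfl, stalkHom_eq_iff_sec_eq.2 fun z hz => ?_⟩
  by_cases hzy : z = y
  · rw [hzy, hy, delta_sec_self]
  · rw [sec_eq_zero_of_mem_grouplike hu rfl hz hzy hy, delta_sec_of_ne hz hzy]

end GrouplikeGerms

section Unit

variable {E : Sh n M}

theorem toSpec_id_bijective : Function.Bijective (toSpec (𝟙 (E.coalg 𝕜))).toFun := by
  constructor
  · intro y z hyz
    have hz : ∀ p : SpecTotal (E.coalg 𝕜), p = (toSpec (𝟙 (E.coalg 𝕜))).toFun z →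
        p.2.1 = stalkHom n 𝕜 p.1 (delta 𝕜 z) := by
      rintro _ rfl
      rfl
    have hsec : (delta 𝕜 y).sec y = (delta 𝕜 z).sec y :=
      stalkHom_eq_iff_sec_eq.1 (hz _ hyz) y rfl
    by_contra hne
    rw [delta_sec_self, delta_sec_of_ne (congrArg Sigma.fst hyz) hne] at hsec
    exact one_ne_zero (α := 𝕜) (congrArg Germ.value hsec)
  · rintro ⟨x, ζ, hζ⟩
    obtain ⟨u, rfl⟩ := stalkHom_surjective x ζ
    obtain ⟨y, rfl, hy⟩ := exists_stalkHom_eq_delta_of_mem_grouplike hζ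
    exact ⟨y, SpecTotal.ext (C := E.coalg 𝕜) rfl (delta 𝕜 y) rfl hy⟩

instance isIso_unit_ccAdjunction : IsIso (ccAdjunction n M 𝕜).unit :=
  have (E : Sh n M) : IsIso ((ccAdjunction n M 𝕜).unit.app E) :=
    Sh.Hom.isIso_of_bijective (toSpec (𝟙 (E.coalg 𝕜))) toSpec_id_bijective
  NatIso.isIso_of_isIso_app _

end Unit

end Adjunction

end SheafCoalg

theorem theorem10 (n : ℕ) (M : Type u) [TopologicalSpace M]
    [ChartedSpace (EuclideanSpace ℝ (Fin n)) M] [IsManifold (𝓡 n) ∞ M] [T2Space M]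
    (𝕜 : Type) [RCLike 𝕜] :
    Nonempty (SheafCoalg.ccFunctor n M 𝕜 ⊣ SheafCoalg.specFunctor n M 𝕜) ∧
      (SheafCoalg.ccFunctor n M 𝕜).Full ∧ (SheafCoalg.ccFunctor n M 𝕜).Faithful :=
  have hff := (SheafCoalg.ccAdjunction n M 𝕜).fullyFaithfulLOfIsIsoUnit
  ⟨⟨SheafCoalg.ccAdjunction n M 𝕜⟩, hff.full, hff.faithful⟩
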